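/- **Setting (special Kähler geometry).** Let $\mathbb C=\begin{pmatrix}0&1\\-1&0\end{pmatrix}$ be the symplectic matrix of size $2n+2$, so that $\mathbb C^{-1}=\mathbb C^T=-\mathbb C$. Let $\mathcal{SK}_n$ be a special Kähler manifold described in a holomorphic chart $z=(z^1,\dots,z^n)$ by a holomorphic symplectic section $\Omega=(X^\Lambda,F_\Sigma)$, $\Lambda,\Sigma=0,\dots,n$, with $-\mathrm i\,\Omega^T\mathbb C\bar\Omega>0$, $\Omega^T\mathbb C\,\partial_i\Omega=0$, Kähler potential $\mathcal K=-\log(-\mathrm i\,\Omega^T\mathbb C\bar\Omega)$ and positive definite Kähler metric $g_{ij^\star}=\partial_i\partial_{j^\star}\mathcal K$. Put $V=e^{\mathcal K/2}\Omega=(L^\Lambda,M_\Sigma)$, $\nabla_iV=(\partial_i+\frac12\partial_i\mathcal K)V=(f_i^\Lambda,h_{\Sigma|i})$, $\mathcal Q=\frac{\mathrm i}2(\partial_i\mathcal K\,dz^i-\partial_{i^\star}\mathcal K\,d\bar z^{i^\star})$, and let $\mathcal N$ be the period matrix, $\bar M_\Lambda=\bar{\mathcal N}_{\Lambda\Sigma}\bar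 L^\Sigma$, $h_{\Lambda|i}=\bar{\mathcal N}_{\Lambda\Sigma}f_i^\Sigma$ (so $\mathrm{Im}\,\mathcal N<0$), and $$\mathcal M_4^{-1}=\begin{pmatrix}\mathrm{Im}\mathcal N+\mathrm{Re}\mathcal N\,\mathrm{Im}\mathcal N^{-1}\mathrm{Re}\mathcal N&-\mathrm{Re}\mathcal N\,\mathrm{Im}\mathcal N^{-1}\\-\mathrm{Im}\mathcal N^{-1}\mathrm{Re}\mathcal N&\mathrm{Im}\mathcal N^{-1}\end{pmatrix}.$$ **Setting (image of the c-map).** On the $(4n+4)$-dimensional manifold with coordinates $U,a\in\mathbb R$, $z^i$, and $\mathbf Z\in\mathbb R^{2n+2}$ put $\Phi=da+\mathbf Z^T\mathbb C^{-1}d\mathbf Z$, $dS=dU+\mathrm i e^{-U}\Phi$, $$ds^2=\tfrac14\left(dU^2+4g_{ij^\star}dz^id\bar z^{j^\star}+e^{-2U}\Phi^2-2e^{-U}d\mathbf Z^T\mathcal M_4^{-1}d\mathbf Z\right),$$ $$\omega=\begin{pmatrix}-\frac{\mathrm i}2\mathcal Q-\frac{\mathrm i}4e^{-U}\Phi&e^{-U/2}V^T\mathbb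 C^{-1}d\mathbf Z\\-e^{-U/2}\bar V^T\mathbb C^{-1}d\mathbf Z&\frac{\mathrm i}2\mathcal Q+\frac{\mathrm i}4e^{-U}\Phi\end{pmatrix},\qquad \mathbf K=d\omega+\omega\wedge\omega .$$ Write $\mathbf K=\mathbf K_{uv}\,dq^u\wedge dq^v$ with $\mathbf K_{uv}=-\mathbf K_{vu}$ and, for a vector field $k$, $\mathbf i_k\mathbf K=\mathbf K_{uv}k^v\,dq^u$. A tri-holomorphic moment map of $k$ is a differentiable $\mathfrak{su}(2)$-valued function $\mathfrak P$ with $\mathbf i_k\mathbf K=d\mathfrak P+[\omega,\mathfrak P]$. **Claim.** (0) $\mathbf K=\begin{pmatrix}\mathfrak u&\mathfrak v\\-\bar{\mathfrak v}&-\mathfrak u\end{pmatrix}$ with $$\mathfrak u=\mathrm i\,K-\tfrac18dS\wedge d\bar S-e^{-U}V^T\mathbb C^{-1}d\mathbf Z\wedge\bar V^T\mathbb C^{-1}d\mathbf Z-\tfrac{\mathrm i}4e^{-U}d\mathbf Z^T\wedge\mathbb C^{-1}d\mathbf Z,\qquad K=\tfrac{\mathrm i}2g_{ij^\star}dz^i\wedge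 d\bar z^{j^\star},$$ $$\mathfrak v=e^{-U/2}\left(dz^i\,\nabla_iV^T\wedge\mathbb C^{-1}d\mathbf Z-\tfrac12dS\wedge V^T\mathbb C^{-1}d\mathbf Z\right).$$ (1) For every $\Lambda\in\mathbb R^{2n+2}$ the vector field $\Lambda^\alpha\partial_{\mathbf Z^\alpha}-\Lambda^T\mathbb C^{-1}\mathbf Z\,\partial_a$ (the Heisenberg translation $\mathbf Z\mapsto\mathbf Z+\Lambda$) is a Killing vector of $ds^2$, with tri-holomorphic moment map $$\mathfrak P_{[\Lambda]}=\begin{pmatrix}-\frac{\mathrm i}4e^{-U}\Lambda^T\mathbb C\mathbf Z&\frac12e^{-U/2}\Lambda^T\mathbb CV\\-\frac12e^{-U/2}\Lambda^T\mathbb C\bar V&\frac{\mathrm i}4e^{-U}\Lambda^T\mathbb C\mathbf Z\end{pmatrix}.$$ (2) $\partial_a$ (the central charge $a\mapsto a+\varepsilon$) is a Killing vector, with tri-holomorphic moment map $\mathfrak P_{[\bullet]}=\mathrm{diag}\left(-\frac{\mathrm i}8e^{-U},\frac{\mathrm i}8e^{-U}\right)$. (3) Let $k^i_{\mathbf I}(z)$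 be a holomorphic vector field on $\mathcal{SK}_n$, $f_{\mathbf I}(z)$ a holomorphic function and $\mathfrak T_{\mathbf I}$ a real matrix with $\mathfrak T_{\mathbf I}^T\mathbb C+\mathbb C\mathfrak T_{\mathbf I}=0$ and $k^i_{\mathbf I}\partial_i\Omega=\mathfrak T_{\mathbf I}\Omega+f_{\mathbf I}\Omega$, and let $\mathcal P_{\mathbf I}=-\frac{\mathrm i}2(k^i_{\mathbf I}\partial_i\mathcal K-k^{i^\star}_{\mathbf I}\partial_{i^\star}\mathcal K)+\mathrm{Im}f_{\mathbf I}$ be its Kähler moment map. Then $k^i_{\mathbf I}\partial_i+k^{i^\star}_{\mathbf I}\partial_{i^\star}+(\mathfrak T_{\mathbf I})^\alpha{}_\beta\mathbf Z^\beta\partial_{\mathbf Z^\alpha}$ is a Killing vector of $ds^2$, with tri-holomorphic moment map $$\mathfrak P_{[\mathbf I]}=\begin{pmatrix}\frac{\mathrm i}4\left(\mathcal P_{\mathbf I}+\frac12e^{-U}\mathbf Z^T\mathbb C\mathfrak T_{\mathbf I}\mathbf Z\right)&-\frac12e^{-U/2}V^T\mathbb C\mathfrak T_{\mathbf I}\mathbf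 Z\\\frac12e^{-U/2}\bar V^T\mathbb C\mathfrak T_{\mathbf I}\mathbf Z&-\frac{\mathrm i}4\left(\mathcal P_{\mathbf I}+\frac12e^{-U}\mathbf Z^T\mathbb C\mathfrak T_{\mathbf I}\mathbf Z\right)\end{pmatrix}.$$ (4) A vector field has at most one tri-holomorphic moment map; in particular the ones above are the only solutions. -/

import Mathlib

noncomputable section

open Complex ComplexConjugate Matrix

namespace CMap

/-! ### Symplectic linear algebra -/

/-- The index set of the `2n+2` symplectic components `(X^Λ, F_Σ)`, `Λ, Σ = 0, …, n`. -/
abbrev SpIdx (n : ℕ) : Type := Fin (n + 1) ⊕ Fin (n + 1)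

/-- The symplectic matrix `ℂ = (0 1; -1 0)`. -/
def spC (n : ℕ) (R : Type) [CommRing R] : Matrix (SpIdx n) (SpIdx n) R :=
  Matrix.fromBlocks 0 1 (-1) 0

/-- The inverse symplectic matrix `ℂ⁻¹ = (0 -1; 1 0)`. -/
def spCInv (n : ℕ) (R : Type) [CommRing R] : Matrix (SpIdx n) (SpIdx n) R :=
  Matrix.fromBlocks 0 (-1) 1 0

theorem spC_mul_spCInv (n : ℕ) (R : Type) [CommRing R] : spC n R * spCInv n R = 1 := by
  simp [spC, spCInv, Matrix.fromBlocks_multiply, Matrix.fromBlocks_one]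

/-- The pairing `xᵀ ℂ y`. -/
def pair {n : ℕ} {R : Type} [CommRing R] (x y : SpIdx n → R) : R :=
  x ⬝ᵥ (spC n R *ᵥ y)

/-- A real symplectic vector regarded as a complex one. -/
def toC {n : ℕ} (x : SpIdx n → ℝ) : SpIdx n → ℂ := fun α => (x α : ℂ)

/-! ### Wirtinger derivatives on `ℂⁿ` -/

/-- `∂_i φ`, that is `∂φ/∂z^i`. -/
def dWirt {n : ℕ} (i : Fin n) (φ : (Fin n → ℂ) → ℂ) (z : Fin n → ℂ) : ℂ :=
  (1 / 2) * (fderiv ℝ φ z (Pi.single i 1) - I * fderiv ℝ φ z (Pi.single i I))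

/-- `∂_{i*} φ`, that is `∂φ/∂z̄^i`. -/
def dWirtBar {n : ℕ} (i : Fin n) (φ : (Fin n → ℂ) → ℂ) (z : Fin n → ℂ) : ℂ :=
  (1 / 2) * (fderiv ℝ φ z (Pi.single i 1) + I * fderiv ℝ φ z (Pi.single i I))

/-! ### Special Kähler geometry -/

/-- The Kähler potential `𝒦 = -log (-i Ωᵀ ℂ Ω̄)` of a symplectic section `Ω`
(the argument of the logarithm is always a real number). -/
def kahlerPotential {n : ℕ} (Ω : (Fin n → ℂ) → SpIdx n → ℂ) (z : Fin n → ℂ) : ℝ :=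
  -Real.log ((-I * pair (Ω z) (star (Ω z))).re)

/-- `∂_i 𝒦`. -/
def dKahler {n : ℕ} (Ω : (Fin n → ℂ) → SpIdx n → ℂ) (i : Fin n) (z : Fin n → ℂ) : ℂ :=
  dWirt i (fun w => (kahlerPotential Ω w : ℂ)) z

/-- `∂_{i*} 𝒦`. -/
def dKahlerBar {n : ℕ} (Ω : (Fin n → ℂ) → SpIdx n → ℂ) (i : Fin n) (z : Fin n → ℂ) : ℂ :=
  dWirtBar i (fun w => (kahlerPotential Ω w : ℂ)) z

/-- The Kähler metric `g_{ij*} = ∂_i ∂_{j*} 𝒦`. -/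
def kahlerMetric {n : ℕ} (Ω : (Fin n → ℂ) → SpIdx n → ℂ) (z : Fin n → ℂ) (i j : Fin n) : ℂ :=
  dWirt i (dKahlerBar Ω j) z

/-- A (projective, or local) special Kähler manifold of complex dimension `n` in a holomorphic
coordinate chart: the holomorphic symplectic section `Ω = (X^Λ, F_Σ)` over an open set of `ℂⁿ`,
with `-i Ωᵀ ℂ Ω̄ > 0`, `Ωᵀ ℂ ∂_i Ω = 0`, and positive definite Kähler metric
`g_{ij*} = ∂_i ∂_{j*} 𝒦`. -/
structure SpecialKahler (n : ℕ) where
  dom : Set (Fin n → ℂ)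
  isOpen_dom : IsOpen dom
  Ω : (Fin n → ℂ) → SpIdx n → ℂ
  holo : DifferentiableOn ℂ Ω dom
  pos : ∀ z ∈ dom, 0 < (-I * pair (Ω z) (star (Ω z))).re
  lagrangian : ∀ z ∈ dom, ∀ i, pair (Ω z) (fun α => dWirt i (fun w => Ω w α) z) = 0
  metric_pos : ∀ z ∈ dom, ∀ c : Fin n → ℂ, c ≠ 0 →
    0 < (∑ i, ∑ j, kahlerMetric Ω z i j * c i * conj (c j)).re

namespace SpecialKahler

variable {n : ℕ} (S : SpecialKahler n)

/-- The covariantly holomorphic section `V = e^{𝒦/2} Ω`. -/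
def V (z : Fin n → ℂ) : SpIdx n → ℂ :=
  fun α => (Real.exp (kahlerPotential S.Ω z / 2) : ℂ) * S.Ω z α

/-- `U_i = ∇_i V = (∂_i + ½ ∂_i 𝒦) V`. -/
def nablaV (i : Fin n) (z : Fin n → ℂ) : SpIdx n → ℂ :=
  fun α => dWirt i (fun w => S.V w α) z + (1 / 2) * dKahler S.Ω i z * S.V z α

/-- `f^Λ_I = (f^Λ_i, L̄^Λ)`: the upper halves of `U_i` and `V̄`. -/
def fMat (z : Fin n → ℂ) : Matrix (Fin (n + 1)) (Fin (n + 1)) ℂ :=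
  Matrix.of fun Λ => Fin.snoc (α := fun _ => ℂ)
    (fun i => S.nablaV i z (Sum.inl Λ)) (conj (S.V z (Sum.inl Λ)))

/-- `h_{Λ|I} = (h_{Λ|i}, M̄_Λ)`: the lower halves of `U_i` and `V̄`. -/
def hMat (z : Fin n → ℂ) : Matrix (Fin (n + 1)) (Fin (n + 1)) ℂ :=
  Matrix.of fun Λ => Fin.snoc (α := fun _ => ℂ)
    (fun i => S.nablaV i z (Sum.inr Λ)) (conj (S.V z (Sum.inr Λ)))

/-- The period matrix `𝒩`, normalised by `M̄_Λ = 𝒩̄_{ΛΣ} L̄^Σ` and `h_{Λ|i} = 𝒩̄_{ΛΣ} f^Σ_i`, so that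
`𝒩̄ = h f⁻¹` and `Im 𝒩` is negative definite. -/
def periodMatrix (z : Fin n → ℂ) : Matrix (Fin (n + 1)) (Fin (n + 1)) ℂ :=
  (S.hMat z * (S.fMat z)⁻¹).map conj

def reN (z : Fin n → ℂ) : Matrix (Fin (n + 1)) (Fin (n + 1)) ℝ := (S.periodMatrix z).map re

def imN (z : Fin n → ℂ) : Matrix (Fin (n + 1)) (Fin (n + 1)) ℝ := (S.periodMatrix z).map im

/-- The real matrix `ℳ₄⁻¹`. -/
def M4Inv (z : Fin n → ℂ) : Matrix (SpIdx n) (SpIdx n) ℝ :=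
  Matrix.fromBlocks
    (S.imN z + S.reN z * (S.imN z)⁻¹ * S.reN z) (-(S.reN z * (S.imN z)⁻¹))
    (-((S.imN z)⁻¹ * S.reN z)) ((S.imN z)⁻¹)

end SpecialKahler

/-- An infinitesimal isometry of the special Kähler geometry: a holomorphic vector field `k^i(z)`
with its holomorphic compensator `f(z)` and its real symplectic generator `T`, so that
`k^i ∂_i Ω = T Ω + f Ω` and `Tᵀ ℂ + ℂ T = 0`.  (Then `k(𝒦) = -f - f̄`, so `k` is a Killing vector
of `g_{ij*}`.) -/
structure SKIsometry {n : ℕ} (S : SpecialKahler n) where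
  k : (Fin n → ℂ) → (Fin n → ℂ)
  f : (Fin n → ℂ) → ℂ
  T : Matrix (SpIdx n) (SpIdx n) ℝ
  holo_k : DifferentiableOn ℂ k S.dom
  holo_f : DifferentiableOn ℂ f S.dom
  symplectic : Tᵀ * spC n ℝ + spC n ℝ * T = 0
  action : ∀ z ∈ S.dom, ∀ α,
    ∑ i, k z i * dWirt i (fun w => S.Ω w α) z =
      (T.map (fun t : ℝ => (t : ℂ)) *ᵥ S.Ω z) α + f z * S.Ω z α

/-- The Kähler moment map
`𝒫 = -(i/2) (k^i ∂_i 𝒦 - k^{i*} ∂_{i*} 𝒦) + Im f` (its values are real numbers). -/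
def SKIsometry.kahlerMoment {n : ℕ} {S : SpecialKahler n} (ξ : SKIsometry S)
    (z : Fin n → ℂ) : ℂ :=
  -(I / 2) * (∑ i, ξ.k z i * dKahler S.Ω i z - ∑ i, conj (ξ.k z i) * dKahlerBar S.Ω i z)
    + ((ξ.f z).im : ℂ)

/-! ### The coordinates `q = (U, a, z, Z)` of the image of the c-map and differential forms -/

/-- The real `(4n+4)`-dimensional coordinate space with points (and tangent vectors)
`(U, a, z^i, Z^α)`. -/
abbrev Coord (n : ℕ) : Type := ℝ × ℝ × (Fin n → ℂ) × (SpIdx n → ℝ)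

variable {n : ℕ}

def cU (q : Coord n) : ℝ := q.1
def ca (q : Coord n) : ℝ := q.2.1
def cz (q : Coord n) : Fin n → ℂ := q.2.2.1
def cZ (q : Coord n) : SpIdx n → ℝ := q.2.2.2

/-- Complex-valued real-linear functionals on the tangent space: values of one-forms. -/
abbrev Covec (n : ℕ) : Type := Coord n →L[ℝ] ℂ

def dU : Covec n := ofRealCLM ∘L ContinuousLinearMap.fst ℝ ℝ _

def da : Covec n :=
  ofRealCLM ∘L ContinuousLinearMap.fst ℝ ℝ _ ∘L ContinuousLinearMap.snd ℝ ℝ _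

def dz (i : Fin n) : Covec n :=
  ContinuousLinearMap.proj i ∘L ContinuousLinearMap.fst ℝ (Fin n → ℂ) (SpIdx n → ℝ) ∘L
    ContinuousLinearMap.snd ℝ ℝ _ ∘L ContinuousLinearMap.snd ℝ ℝ _

def dzBar (i : Fin n) : Covec n := conjCLE.toContinuousLinearMap ∘L dz i

def dZ (α : SpIdx n) : Covec n :=
  ofRealCLM ∘L ContinuousLinearMap.proj α ∘L
    ContinuousLinearMap.snd ℝ (Fin n → ℂ) (SpIdx n → ℝ) ∘L
    ContinuousLinearMap.snd ℝ ℝ _ ∘L ContinuousLinearMap.snd ℝ ℝ _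

/-- The covector `wᵀ ℂ⁻¹ dZ`. -/
def pairInvdZ (w : SpIdx n → ℂ) : Covec n := ∑ α, (w ᵥ* spCInv n ℂ) α • dZ α

/-- The wedge product of two one-forms, `(α ∧ β)(X, Y) = α(X) β(Y) - α(Y) β(X)`. -/
def wedge (α β : Covec n) (X Y : Coord n) : ℂ := α X * β Y - α Y * β X

/-- The exterior derivative of a one-form, evaluated on two tangent vectors. -/
def extD (α : Coord n → Covec n) (q X Y : Coord n) : ℂ :=
  extDeriv (fun p => ContinuousAlternatingMap.ofSubsingleton ℝ (Coord n) ℂ (0 : Fin 1) (α p))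
    q ![X, Y]

namespace SpecialKahler

variable (S : SpecialKahler n)

/-- The coordinate domain of the image of the c-map: `U, a, Z` are arbitrary, `z` is in the chart
of the special Kähler manifold. -/
def QM : Set (Coord n) := {q | cz q ∈ S.dom}

/-- The Kähler connection `𝒬 = (i/2) (∂_i 𝒦 dz^i - ∂_{i*} 𝒦 dz̄^{i*})`. -/
def connQ (q : Coord n) : Covec n :=
  (I / 2) • (∑ i, dKahler S.Ω i (cz q) • dz i - ∑ i, dKahlerBar S.Ω i (cz q) • dzBar i)

end SpecialKahler

/-- `Φ = da + Zᵀ ℂ⁻¹ dZ`. -/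
def formPhi (q : Coord n) : Covec n := da + pairInvdZ (toC (cZ q))

/-- `e^{t}` as a complex number, for real `t`. -/
def cexpR (t : ℝ) : ℂ := (Real.exp t : ℂ)

namespace SpecialKahler

variable (S : SpecialKahler n)

/-- The metric
`ds² = ¼ (dU² + 4 g_{ij*} dz^i dz̄^{j*} + e^{-2U} (da + Zᵀ ℂ⁻¹ dZ)² - 2 e^{-U} dZᵀ ℳ₄⁻¹ dZ)`
as a symmetric bilinear form on tangent vectors (`Φ` takes real values). -/
def metric (q X Y : Coord n) : ℝ :=
  (1 / 4) * (cU X * cU Y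
    + 4 * (∑ i, ∑ j, kahlerMetric S.Ω (cz q) i j * cz X i * conj (cz Y j)).re
    + Real.exp (-2 * cU q) * ((formPhi q X).re * (formPhi q Y).re)
    - 2 * Real.exp (-cU q) * (cZ X ⬝ᵥ (S.M4Inv (cz q) *ᵥ cZ Y)))

/-- The `su(2)`-connection, a `2 × 2` matrix of one-forms. -/
def omega (q : Coord n) : Matrix (Fin 2) (Fin 2) (Covec n) :=
  !![-(I / 2) • S.connQ q - (I / 4 * cexpR (-cU q)) • formPhi q,
      cexpR (-cU q / 2) • pairInvdZ (S.V (cz q));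
     -(cexpR (-cU q / 2) • pairInvdZ (star (S.V (cz q)))),
      (I / 2) • S.connQ q + (I / 4 * cexpR (-cU q)) • formPhi q]

/-- The matrix `ω(X)` for a tangent vector `X`. -/
def omegaAt (q X : Coord n) : Matrix (Fin 2) (Fin 2) ℂ := (S.omega q).map fun α => α X

/-- The matrix-valued two-form `K = dω + ω ∧ ω`, evaluated on two tangent vectors. -/
def curvK (q X Y : Coord n) : Matrix (Fin 2) (Fin 2) ℂ :=
  Matrix.of fun i j =>
    extD (fun p => S.omega p i j) q X Y + ∑ l, wedge (S.omega q i l) (S.omega q l j) X Y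

/-- The Kähler two-form `(i/2) g_{ij*} dz^i ∧ dz̄^{j*}`. -/
def kahlerForm (q X Y : Coord n) : ℂ :=
  (I / 2) * ∑ i, ∑ j, kahlerMetric S.Ω (cz q) i j * wedge (dz i) (dzBar j) X Y

/-- `DV^α = dz^i (∇_i V)^α`. -/
def DV (q : Coord n) (α : SpIdx n) : Covec n := ∑ i, S.nablaV i (cz q) α • dz i

end SpecialKahler

/-- `dS = dU + i e^{-U} Φ`. -/
def formdS (q : Coord n) : Covec n := dU + (I * cexpR (-cU q)) • formPhi q

/-- `dS̄ = dU - i e^{-U} Φ`. -/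
def formdSBar (q : Coord n) : Covec n := dU - (I * cexpR (-cU q)) • formPhi q

namespace SpecialKahler

variable (S : SpecialKahler n)

/-- The two-form
`𝔲 = i K - ⅛ dS ∧ dS̄ - e^{-U} Vᵀℂ⁻¹dZ ∧ V̄ᵀℂ⁻¹dZ - (i/4) e^{-U} dZᵀ ∧ ℂ⁻¹ dZ`,
with `K` the Kähler form. -/
def formu (q X Y : Coord n) : ℂ :=
  I * S.kahlerForm q X Y - (1 / 8) * wedge (formdS q) (formdSBar q) X Y
    - cexpR (-cU q) *
        wedge (pairInvdZ (S.V (cz q))) (pairInvdZ (star (S.V (cz q)))) X Y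
    - (I / 4) * cexpR (-cU q) * ∑ α, ∑ β, spCInv n ℂ α β * wedge (dZ α) (dZ β) X Y

/-- The two-form `𝔳 = e^{-U/2} (DVᵀ ∧ ℂ⁻¹ dZ - ½ dS ∧ Vᵀ ℂ⁻¹ dZ)`. -/
def formv (q X Y : Coord n) : ℂ :=
  cexpR (-cU q / 2) *
    (∑ α, ∑ β, spCInv n ℂ α β * wedge (S.DV q α) (dZ β) X Y
      - (1 / 2) * wedge (formdS q) (pairInvdZ (S.V (cz q))) X Y)

/-- The contraction `i_k K`: writing `K = K_{uv} dq^u ∧ dq^v` with `K_{uv} = -K_{vu}`, it is the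
one-form `K_{uv} k^v dq^u`; as `(dq^u ∧ dq^v)(X, Y) = X^u Y^v - X^v Y^u`, its value on `X` is
`½ K(X, k)`. -/
def contractK (k : Coord n → Coord n) (q X : Coord n) : Matrix (Fin 2) (Fin 2) ℂ :=
  (1 / 2 : ℂ) • S.curvK q X (k q)

/-- `P` is a tri-holomorphic moment map of the vector field `k`: it is a differentiable
`su(2)`-valued function on the image of the c-map with `i_k K = dP + [ω, P]`. -/
def IsMomentMap (k : Coord n → Coord n) (P : Coord n → Matrix (Fin 2) (Fin 2) ℂ) : Prop :=
  ∀ q ∈ S.QM,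
    ((P q)ᴴ = -P q ∧ (P q).trace = 0) ∧
    (∀ i j, DifferentiableAt ℝ (fun p => P p i j) q) ∧
    ∀ X, S.contractK k q X =
      (Matrix.of fun i j => fderiv ℝ (fun p => P p i j) q X)
        + (S.omegaAt q X * P q - P q * S.omegaAt q X)

/-- `k` is a Killing vector field of the metric: `ℓ_k ds² = 0`. -/
def IsKilling (k : Coord n → Coord n) : Prop :=
  ∀ q ∈ S.QM, DifferentiableAt ℝ k q ∧ ∀ X Y,
    DifferentiableAt ℝ (fun p => S.metric p X Y) q ∧
    fderiv ℝ (fun p => S.metric p X Y) q (k q)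
      + S.metric q (fderiv ℝ k q X) Y + S.metric q X (fderiv ℝ k q Y) = 0

end SpecialKahler

/-! ### The three kinds of isometries and their moment maps -/

/-- The Heisenberg translation `Λ^α ∂/∂Z^α - Λᵀ ℂ⁻¹ Z ∂/∂a`. -/
def killHeis (Λ : SpIdx n → ℝ) (q : Coord n) : Coord n :=
  (0, -(Λ ⬝ᵥ (spCInv n ℝ *ᵥ cZ q)), 0, Λ)

/-- The central charge `∂/∂a`. -/
def killCentral (_ : Coord n) : Coord n := (0, 1, 0, 0)

/-- The lift `k^i ∂_i + k^{i*} ∂_{i*} + T^α_β Z^β ∂/∂Z^α` of an isometry of the special Kähler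
base. -/
def killSK {S : SpecialKahler n} (ξ : SKIsometry S) (q : Coord n) : Coord n :=
  (0, 0, ξ.k (cz q), ξ.T *ᵥ cZ q)

namespace SpecialKahler

variable (S : SpecialKahler n)

def momentHeis (Λ : SpIdx n → ℝ) (q : Coord n) : Matrix (Fin 2) (Fin 2) ℂ :=
  !![-(I / 4) * cexpR (-cU q) * pair (toC Λ) (toC (cZ q)),
      (1 / 2) * cexpR (-cU q / 2) * pair (toC Λ) (S.V (cz q));
     -(1 / 2) * cexpR (-cU q / 2) * pair (toC Λ) (star (S.V (cz q))),
      (I / 4) * cexpR (-cU q) * pair (toC Λ) (toC (cZ q))]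

end SpecialKahler

def momentCentral (q : Coord n) : Matrix (Fin 2) (Fin 2) ℂ :=
  !![-(I / 8) * cexpR (-cU q), 0;
     0, (I / 8) * cexpR (-cU q)]

def momentSK {S : SpecialKahler n} (ξ : SKIsometry S) (q : Coord n) :
    Matrix (Fin 2) (Fin 2) ℂ :=
  !![(I / 4) * (ξ.kahlerMoment (cz q)
        + (1 / 2) * cexpR (-cU q) * pair (toC (cZ q)) (toC (ξ.T *ᵥ cZ q))),
      -(1 / 2) * cexpR (-cU q / 2) * pair (S.V (cz q)) (toC (ξ.T *ᵥ cZ q));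
     (1 / 2) * cexpR (-cU q / 2) * pair (star (S.V (cz q))) (toC (ξ.T *ᵥ cZ q)),
      -(I / 4) * (ξ.kahlerMoment (cz q)
        + (1 / 2) * cexpR (-cU q) * pair (toC (cZ q)) (toC (ξ.T *ᵥ cZ q)))]

end CMap

end

/-! Everything on the base reduces to four expressions built from `Ω`: `dSec` (∂_vΩ), `conn` (v^i
∂_i𝒦), `covD` (v^i ∇_iV) and `herm` (g_{ij*} v^i w̄^j = i⟨∇_vV, conj ∇_wV⟩), together with ⟨V, V̄⟩ =
i and ⟨V, ∇_vV⟩ = 0. The derivative of ∂_w𝒦 along v is a part symmetric in v, w plus `herm z w v`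
(`hasDirDeriv_conn`). Antisymmetrising `dω` therefore leaves only the Kähler form from `∂𝒦`, and `ω
∧ ω` supplies the remaining quadratic terms and turns dV into DV. This is the curvature formula
`curvK_eq`.

The moment map equations then become algebraic identities between `formu`, `formv` and the
derivatives of the proposed matrices, to be checked on the first row only (`isMomentMap_of`). For an
isometry of the base, the inputs are ∇_kV = TV + cV, where c = k(𝒦) + f is imaginary, 𝒫 = -ic, and
the formula for d𝒫.

For the Killing property of the lifted isometries the delicate term is ℳ₄⁻¹. Differentiating the
period matrix is avoided: ℳ₄⁻¹ is the real matrix acting as iℂ on the span of ∇_iV and V̄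
(`matC_M4Inv_frame`, `eq_zero_of_matC_mulVec_frame`). Along k a vector u of this span changes by Tu
plus a vector of the span, so the symplectic property of T gives the invariance (`M4Inv_invariant`).

For uniqueness, a difference D of two moment maps satisfies dD + [ω, D] = 0. Its off-diagonal entry
does not depend on U, because ω(∂_U) = 0, while its a-derivative is (i/2)e^{-U} times itself; hence
it vanishes. The ∂_Z directions then kill the diagonal, since V ≠ 0. Only first derivatives of D
enter. -/

noncomputable section

open Complex ComplexConjugate Matrix

namespace CMap

/-! ### Regularity of holomorphic maps in several variables: second derivatives exist and are
symmetric. -/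

section Holomorphic

open Metric Filter Topology MeasureTheory

variable {E F : Type*} [NormedAddCommGroup E] [NormedSpace ℂ E]
  [NormedAddCommGroup F] [NormedSpace ℂ F]

/-- Around a point of an open set of holomorphy, the derivative is bounded. -/
theorem exists_ball_norm_fderiv_le {f : E → F} {U : Set E} (hU : IsOpen U)
    (hf : DifferentiableOn ℂ f U) {x : E} (hx : x ∈ U) :
    ∃ r > 0, ball x (2 * r) ⊆ U ∧ ∀ y ∈ ball x (2 * r), ‖fderiv ℂ f y‖ ≤ 1 / r := by
  have hc : ContinuousAt f x := (hf.continuousOn.continuousAt (hU.mem_nhds hx))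
  obtain ⟨δ, hδ, hδf⟩ := Metric.continuousAt_iff.1 hc 1 one_pos
  obtain ⟨ε, hε, hεU⟩ := Metric.isOpen_iff.1 hU x hx
  -- With r a quarter of the radius, a ball of radius 2r about a point within 2r of `x` stays where
  -- `f` is within 1 of `f x`. There `f` deviates from its central value by at most 2, and the
  -- Schwarz bound is 2 / (2r) = 1 / r.
  have hrpos : 0 < min δ ε / 4 := by positivity
  refine ⟨min δ ε / 4, hrpos, fun y hy => hεU ?_, fun y hy => ?_⟩
  · rw [mem_ball] at hy ⊢
    linarith [min_le_right δ ε]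
  · rw [mem_ball] at hy
    have hsub : ∀ w ∈ ball y (2 * (min δ ε / 4)), dist w x < min δ ε := fun w hw => by
      rw [mem_ball] at hw
      linarith [dist_triangle w y x]
    have hd : DifferentiableOn ℂ f (ball y (2 * (min δ ε / 4))) :=
      hf.mono fun w hw => hεU ((hsub w hw).trans_le (min_le_right _ _))
    have hm : Set.MapsTo f (ball y (2 * (min δ ε / 4))) (closedBall (f y) 2) := fun w hw => by
      have h1 := hδf ((hsub w hw).trans_le (min_le_left _ _))
      have h2 := hδf ((hsub y (mem_ball_self (by positivity))).trans_le (min_le_left _ _))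
      rw [mem_closedBall]
      linarith [dist_triangle_right (f w) (f y) (f x)]
    have := norm_fderiv_le_div_of_mapsTo_ball hd hm (by positivity)
    refine this.trans (le_of_eq ?_)
    field_simp

variable [FiniteDimensional ℂ E] [FiniteDimensional ℂ F]

/-- The directional derivatives of a holomorphic function are holomorphic. -/
theorem differentiableAt_fderiv_apply {f : E → F} {U : Set E} (hU : IsOpen U)
    (hf : DifferentiableOn ℂ f U) {x : E} (hx : x ∈ U) (v : E) :
    DifferentiableAt ℂ (fun y => fderiv ℂ f y v) x := by
  have := FiniteDimensional.complete ℂ F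
  obtain ⟨r, hr, hrU, hbd⟩ := exists_ball_norm_fderiv_le hU hf hx
  obtain ⟨ρ, hρ, hρv⟩ : ∃ ρ > 0, ρ * ‖v‖ < r :=
    ⟨r / (2 * (‖v‖ + 1)), by positivity, by
      rw [div_mul_eq_mul_div, div_lt_iff₀ (by positivity)]; nlinarith [norm_nonneg v]⟩
  have hmem : ∀ y ∈ ball x r, ∀ t ∈ closedBall (0 : ℂ) ρ, y + t • v ∈ ball x (2 * r) := by
    intro y hy t ht
    rw [mem_ball, dist_eq_norm] at hy ⊢
    rw [mem_closedBall_zero_iff] at ht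
    have h1 : ‖t • v‖ ≤ ρ * ‖v‖ := by rw [norm_smul]; gcongr
    calc ‖y + t • v - x‖ = ‖(y - x) + t • v‖ := by congr 1; abel
      _ ≤ ‖y - x‖ + ‖t • v‖ := norm_add_le _ _
      _ < 2 * r := by linarith
  have hdiff : ∀ y ∈ ball x r, ∀ t ∈ closedBall (0 : ℂ) ρ, DifferentiableAt ℂ f (y + t • v) :=
    fun y hy t ht => hf.differentiableAt (hU.mem_nhds (hrU (hmem y hy t ht)))
  -- The kernel γ'(θ)/γ(θ)² of Cauchy's formula for the derivative at 0 of t ↦ f(y + tv). Holomorphy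
  -- in `y` then follows by differentiating under the integral sign.
  let c : ℝ → ℂ := fun θ => deriv (circleMap 0 ρ) θ * ((circleMap 0 ρ θ - 0) ^ 2)⁻¹
  have hcirc : ∀ θ, circleMap 0 ρ θ ∈ closedBall (0 : ℂ) ρ := circleMap_mem_closedBall 0 hρ.le
  have hγ : ∀ θ, circleMap 0 ρ θ ≠ 0 := fun θ => circleMap_ne_center hρ.ne'
  have hcc : Continuous c := by
    have h0 : Continuous (circleMap 0 ρ) := continuous_circleMap 0 ρ
    simp only [c, deriv_circleMap]
    refine (h0.mul continuous_const).mul (((h0.sub continuous_const).pow 2).inv₀ fun θ => ?_)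
    simpa using hγ θ
  have hcauchy : ∀ y ∈ ball x r, fderiv ℂ f y v =
      (2 * Real.pi * I : ℂ)⁻¹ • ∫ θ in (0 : ℝ)..2 * Real.pi, c θ • f (y + circleMap 0 ρ θ • v) := by
    intro y hy
    have hline : HasDerivAt (fun t : ℂ => y + t • v) v 0 := by
      simpa using ((hasDerivAt_id (0 : ℂ)).smul_const v).const_add y
    have h0 : HasDerivAt (fun t : ℂ => f (y + t • v)) (fderiv ℂ f y v) 0 := by
      have := hdiff y hy 0 (by simp [hρ.le])
      have h1 := HasFDerivAt.comp_hasDerivAt (0 : ℂ) this.hasFDerivAt hline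
      simpa [Function.comp_def] using h1
    have hopen : IsOpen ((fun t : ℂ => y + t • v) ⁻¹' U) :=
      hU.preimage (by fun_prop)
    have hdl : DifferentiableOn ℂ (fun t : ℂ => f (y + t • v))
        ((fun t : ℂ => y + t • v) ⁻¹' U) :=
      hf.comp (by fun_prop) (Set.mapsTo_preimage _ _)
    rw [← h0.deriv, ← Complex.cderiv_eq_deriv hopen hdl hρ
      (fun t ht => hrU (hmem y hy t ht)), Complex.cderiv, circleIntegral]
    simp only [c, mul_smul]
  have hev : (fun y => fderiv ℂ f y v) =ᶠ[𝓝 x] fun y =>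
      (2 * Real.pi * I : ℂ)⁻¹ • ∫ θ in (0 : ℝ)..2 * Real.pi, c θ • f (y + circleMap 0 ρ θ • v) := by
    filter_upwards [ball_mem_nhds x hr] with y hy using hcauchy y hy
  refine DifferentiableAt.congr_of_eventuallyEq ?_ hev
  refine DifferentiableAt.const_smul ?_ _
  have hFc : ∀ y ∈ ball x r, Continuous fun θ : ℝ => c θ • f (y + circleMap 0 ρ θ • v) := by
    intro y hy
    refine hcc.smul (continuous_iff_continuousAt.2 fun θ => ?_)
    have h1 : ContinuousAt (fun θ : ℝ => y + circleMap 0 ρ θ • v) θ :=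
      (continuous_const.add ((continuous_circleMap 0 ρ).smul continuous_const)).continuousAt
    exact ContinuousAt.comp (g := f) (hdiff y hy _ (hcirc θ)).continuousAt h1
  borelize E
  -- Continuity of the derivative is not yet available at this stage, but a derivative is always
  -- measurable, and the bound 1 / r dominates it.
  have hmeas : AEStronglyMeasurable (fun θ : ℝ => c θ • fderiv ℂ f (x + circleMap 0 ρ θ • v))
      (volume.restrict (Set.uIoc 0 (2 * Real.pi))) := by
    have := FiniteDimensional.proper ℂ (E →L[ℂ] F)
    refine Measurable.aestronglyMeasurable ?_
    borelize (E →L[ℂ] F)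
    refine hcc.measurable.smul ((measurable_fderiv ℂ f).comp ?_)
    exact (continuous_const.add
      ((continuous_circleMap 0 ρ).smul continuous_const)).measurable
  refine (intervalIntegral.hasFDerivAt_integral_of_dominated_of_fderiv_le
    (𝕜 := ℂ) (F := fun y (θ : ℝ) => c θ • f (y + circleMap 0 ρ θ • v))
    (F' := fun y (θ : ℝ) => c θ • fderiv ℂ f (y + circleMap 0 ρ θ • v))
    (bound := fun θ => ‖c θ‖ * (1 / r)) (ball_mem_nhds x hr) ?_ ?_ hmeas ?_ ?_ ?_).differentiableAt
  · filter_upwards [ball_mem_nhds x hr] with y hy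
    exact (hFc y hy).aestronglyMeasurable
  · exact (hFc x (mem_ball_self hr)).intervalIntegrable _ _
  · refine Eventually.of_forall fun θ _ y hy => ?_
    rw [norm_smul]
    gcongr
    exact hbd _ (hmem y hy _ (hcirc θ))
  · exact (hcc.norm.mul continuous_const).intervalIntegrable _ _
  · refine Eventually.of_forall fun θ _ y hy => ?_
    have h1 : HasFDerivAt (fun y => y + circleMap 0 ρ θ • v) (ContinuousLinearMap.id ℂ E) y :=
      (hasFDerivAt_id y).add_const _
    have h2 := HasFDerivAt.comp y (hdiff y hy _ (hcirc θ)).hasFDerivAt h1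
    rw [ContinuousLinearMap.comp_id] at h2
    exact h2.const_smul (c θ)

/-- The derivative of a holomorphic function is holomorphic. -/
theorem differentiableAt_fderiv {f : E → F} {U : Set E} (hU : IsOpen U)
    (hf : DifferentiableOn ℂ f U) {x : E} (hx : x ∈ U) : DifferentiableAt ℂ (fderiv ℂ f) x := by
  -- In finite dimension a linear map is the tuple of its values on a basis, so differentiability of
  -- `fderiv` reduces to that of directional derivatives.
  let e := (ContinuousLinearEquiv.piRing (𝕜 := ℂ) (E := F) (Fin (Module.finrank ℂ E)))
  let b : (Fin (Module.finrank ℂ E) → ℂ) ≃L[ℂ] E :=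
    ContinuousLinearEquiv.ofFinrankEq (by simp)
  let g : (E →L[ℂ] F) ≃L[ℂ] (Fin (Module.finrank ℂ E) → F) :=
    (b.symm.arrowCongr (ContinuousLinearEquiv.refl ℂ F)).trans e
  rw [← g.comp_differentiableAt_iff, differentiableAt_pi]
  intro i
  exact differentiableAt_fderiv_apply hU hf hx (b (Pi.single i 1))

theorem fderiv_fderiv_symm {f : E → F} {U : Set E} (hU : IsOpen U)
    (hf : DifferentiableOn ℂ f U) {x : E} (hx : x ∈ U) (v w : E) :
    fderiv ℂ (fun y => fderiv ℂ f y v) x w = fderiv ℂ (fun y => fderiv ℂ f y w) x v := by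
  have hd := differentiableAt_fderiv hU hf hx
  have key := second_derivative_symmetric_of_eventually (𝕜 := ℂ)
    (Filter.eventually_of_mem (hU.mem_nhds hx) fun y hy =>
      (hf.differentiableAt (hU.mem_nhds hy)).hasFDerivAt) hd.hasFDerivAt v w
  have h : ∀ u u', fderiv ℂ (fun y => fderiv ℂ f y u) x u' = fderiv ℂ (fderiv ℂ f) x u' u := by
    intro u u'
    rw [fderiv_clm_apply hd (differentiableAt_const u)]
    simp
  rw [h, h, key]

end Holomorphic

/-! ### Algebra of the symplectic pairing. -/

section Pairing

variable {n : ℕ} {R : Type} [CommRing R]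

theorem pair_eq_sum (x y : SpIdx n → R) :
    pair x y = ∑ i, (x (Sum.inl i) * y (Sum.inr i) - x (Sum.inr i) * y (Sum.inl i)) := by
  simp [pair, spC, dotProduct, fromBlocks_mulVec, neg_mulVec, sub_eq_add_neg,
    Finset.sum_add_distrib]

theorem pair_add_left (x x' y : SpIdx n → R) : pair (x + x') y = pair x y + pair x' y := by
  simp [pair]

theorem pair_add_right (x y y' : SpIdx n → R) : pair x (y + y') = pair x y + pair x y' := by
  simp [pair, mulVec_add]

theorem pair_sub_left (x x' y : SpIdx n → R) : pair (x - x') y = pair x y - pair x' y := by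
  simp [pair]

theorem pair_sub_right (x y y' : SpIdx n → R) : pair x (y - y') = pair x y - pair x y' := by
  simp [pair, mulVec_sub]

theorem pair_smul_left (c : R) (x y : SpIdx n → R) : pair (c • x) y = c * pair x y := by
  simp [pair]

theorem pair_smul_right (c : R) (x y : SpIdx n → R) : pair x (c • y) = c * pair x y := by
  simp [pair, mulVec_smul]

theorem pair_swap (x y : SpIdx n → R) : pair x y = -pair y x := by
  rw [pair_eq_sum, pair_eq_sum, ← Finset.sum_neg_distrib]
  exact Finset.sum_congr rfl fun i _ => by ring

theorem pair_self (x : SpIdx n → R) : pair x x = 0 := by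
  rw [pair_eq_sum]
  exact Finset.sum_eq_zero fun i _ => by ring

theorem pair_zero_left (y : SpIdx n → R) : pair 0 y = 0 := by simp [pair]

theorem pair_zero_right (y : SpIdx n → R) : pair y 0 = 0 := by simp [pair]

theorem conj_pair (x y : SpIdx n → ℂ) : conj (pair x y) = pair (star x) (star y) := by
  simp [pair_eq_sum]

theorem pair_toC (x y : SpIdx n → ℝ) : pair (toC x) (toC y) = ((pair x y : ℝ) : ℂ) := by
  simp [pair_eq_sum, toC]

theorem star_toC (x : SpIdx n → ℝ) : star (toC x) = toC x := by
  ext α; simp [toC]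

theorem spCInv_eq_neg : spCInv n R = -spC n R := by
  simp [spC, spCInv, fromBlocks_neg]

theorem pair_mulVec_left (T : Matrix (SpIdx n) (SpIdx n) R) (h : Tᵀ * spC n R + spC n R * T = 0)
    (x y : SpIdx n → R) : pair (T *ᵥ x) y = -pair x (T *ᵥ y) := by
  have h' : Tᵀ * spC n R = -(spC n R * T) := eq_neg_of_add_eq_zero_left h
  unfold pair
  rw [← vecMul_transpose, ← dotProduct_mulVec, mulVec_mulVec, mulVec_mulVec, h', neg_mulVec,
    dotProduct_neg]

/-- The symplectic pairing is nondegenerate. -/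
theorem exists_pair_toC_ne_zero {x : SpIdx n → ℂ} (hx : x ≠ 0) :
    ∃ y : SpIdx n → ℝ, pair x (toC y) ≠ 0 := by
  obtain ⟨α, hα⟩ := Function.ne_iff.1 hx
  rcases α with i | i
  · refine ⟨Pi.single (Sum.inr i) 1, ?_⟩
    rw [pair_eq_sum, Finset.sum_eq_single i]
    · simpa [toC] using hα
    · intro j _ hj; simp [toC, hj]
    · simp
  · refine ⟨Pi.single (Sum.inl i) 1, ?_⟩
    rw [pair_eq_sum, Finset.sum_eq_single i]
    · simpa [toC] using hα
    · intro j _ hj; simp [toC, hj]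
    · simp

end Pairing

/-! ### Directional derivatives -/

section DirDeriv

variable {E G : Type*} [NormedAddCommGroup E] [NormedSpace ℝ E]
  [NormedAddCommGroup G] [NormedSpace ℝ G]

/-- `F` is differentiable at `q`, with derivative `d` in the direction `v`. -/
def HasDirDeriv (F : E → G) (d : G) (q v : E) : Prop :=
  DifferentiableAt ℝ F q ∧ fderiv ℝ F q v = d

theorem hasDirDeriv_of_hasFDerivAt {F : E → G} {F' : E →L[ℝ] G} {q : E} (h : HasFDerivAt F F' q)
    (v : E) : HasDirDeriv F (F' v) q v :=
  ⟨h.differentiableAt, by rw [h.fderiv]⟩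

namespace HasDirDeriv

variable {q v : E}

theorem congr_deriv {F : E → G} {d d' : G} (h : HasDirDeriv F d q v) (hd : d = d') :
    HasDirDeriv F d' q v := hd ▸ h

theorem congr_of_eventuallyEq {F F' : E → G} {d : G} (h : HasDirDeriv F d q v)
    (hF : F' =ᶠ[nhds q] F) : HasDirDeriv F' d q v :=
  ⟨h.1.congr_of_eventuallyEq hF, by rw [hF.fderiv_eq, h.2]⟩

theorem const (c : G) : HasDirDeriv (fun _ : E => c) 0 q v :=
  ⟨differentiableAt_const c, by simp⟩

theorem clm (L : E →L[ℝ] G) : HasDirDeriv (fun p => L p) (L v) q v :=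
  hasDirDeriv_of_hasFDerivAt L.hasFDerivAt v

theorem clm_comp {H : Type*} [NormedAddCommGroup H] [NormedSpace ℝ H] (L : G →L[ℝ] H)
    {F : E → G} {d : G} (h : HasDirDeriv F d q v) : HasDirDeriv (fun p => L (F p)) (L d) q v := by
  have := hasDirDeriv_of_hasFDerivAt (L.hasFDerivAt.comp q h.1.hasFDerivAt) v
  rw [← h.2]; exact this

theorem comp_clm {H : Type*} [NormedAddCommGroup H] [NormedSpace ℝ H] (L : H →L[ℝ] E)
    {F : E → G} {d : G} {p w : H} (h : HasDirDeriv F d (L p) (L w)) :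
    HasDirDeriv (fun p => F (L p)) d p w := by
  have := hasDirDeriv_of_hasFDerivAt (HasFDerivAt.comp p h.1.hasFDerivAt L.hasFDerivAt) w
  rw [← h.2]; exact this

theorem add {F F' : E → G} {d d' : G} (h : HasDirDeriv F d q v) (h' : HasDirDeriv F' d' q v) :
    HasDirDeriv (fun p => F p + F' p) (d + d') q v := by
  rw [← h.2, ← h'.2]
  exact hasDirDeriv_of_hasFDerivAt (h.1.hasFDerivAt.add h'.1.hasFDerivAt) v

theorem sub {F F' : E → G} {d d' : G} (h : HasDirDeriv F d q v) (h' : HasDirDeriv F' d' q v) :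
    HasDirDeriv (fun p => F p - F' p) (d - d') q v := by
  rw [← h.2, ← h'.2]
  exact hasDirDeriv_of_hasFDerivAt (h.1.hasFDerivAt.sub h'.1.hasFDerivAt) v

theorem neg {F : E → G} {d : G} (h : HasDirDeriv F d q v) :
    HasDirDeriv (fun p => -F p) (-d) q v := by
  rw [← h.2]
  exact hasDirDeriv_of_hasFDerivAt h.1.hasFDerivAt.neg v

theorem sum {ι : Type*} {s : Finset ι} {F : ι → E → G} {d : ι → G}
    (h : ∀ i ∈ s, HasDirDeriv (F i) (d i) q v) :
    HasDirDeriv (fun p => ∑ i ∈ s, F i p) (∑ i ∈ s, d i) q v := by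
  refine ⟨DifferentiableAt.fun_sum fun i hi => (h i hi).1, ?_⟩
  rw [fderiv_fun_sum fun i hi => (h i hi).1, _root_.sum_apply]
  exact Finset.sum_congr rfl fun i hi => (h i hi).2

theorem smul {𝕜 : Type*} [NormedField 𝕜] [NormedAlgebra ℝ 𝕜] [NormedSpace 𝕜 G]
    [IsScalarTower ℝ 𝕜 G] {c : E → 𝕜} {F : E → G} {c' : 𝕜} {d : G} (hc : HasDirDeriv c c' q v)
    (h : HasDirDeriv F d q v) :
    HasDirDeriv (fun p => c p • F p) (c' • F q + c q • d) q v := by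
  rw [← h.2, ← hc.2]
  have := hasDirDeriv_of_hasFDerivAt (hc.1.hasFDerivAt.smul h.1.hasFDerivAt) v
  refine this.congr_deriv ?_
  simp [add_comm]

theorem mul {𝔸 : Type*} [NormedCommRing 𝔸] [NormedAlgebra ℝ 𝔸] {F F' : E → 𝔸} {d d' : 𝔸}
    (h : HasDirDeriv F d q v) (h' : HasDirDeriv F' d' q v) :
    HasDirDeriv (fun p => F p * F' p) (d * F' q + F q * d') q v := by
  rw [← h.2, ← h'.2]
  have := hasDirDeriv_of_hasFDerivAt (h.1.hasFDerivAt.mul h'.1.hasFDerivAt) v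
  refine this.congr_deriv ?_
  simp [mul_comm, add_comm]

theorem const_mul {𝔸 : Type*} [NormedCommRing 𝔸] [NormedAlgebra ℝ 𝔸] (c : 𝔸) {F : E → 𝔸} {d : 𝔸}
    (h : HasDirDeriv F d q v) : HasDirDeriv (fun p => c * F p) (c * d) q v :=
  ((const c).mul h).congr_deriv (by simp)

theorem mul_const {𝔸 : Type*} [NormedCommRing 𝔸] [NormedAlgebra ℝ 𝔸] (c : 𝔸) {F : E → 𝔸} {d : 𝔸}
    (h : HasDirDeriv F d q v) : HasDirDeriv (fun p => F p * c) (d * c) q v :=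
  (h.mul (const c)).congr_deriv (by simp)

theorem scomp {g : ℝ → ℝ} {g' : ℝ} {F : E → ℝ} {d : ℝ} (h : HasDirDeriv F d q v)
    (hg : HasDerivAt g g' (F q)) : HasDirDeriv (fun p => g (F p)) (g' * d) q v := by
  rw [← h.2]
  have := hasDirDeriv_of_hasFDerivAt (HasDerivAt.comp_hasFDerivAt q hg h.1.hasFDerivAt) v
  exact this.congr_deriv (by simp)

theorem ofReal {F : E → ℝ} {d : ℝ} (h : HasDirDeriv F d q v) :
    HasDirDeriv (fun p => (F p : ℂ)) (d : ℂ) q v := h.clm_comp ofRealCLM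

theorem re {F : E → ℂ} {d : ℂ} (h : HasDirDeriv F d q v) :
    HasDirDeriv (fun p => (F p).re) d.re q v := h.clm_comp reCLM

theorem complexConj {F : E → ℂ} {d : ℂ} (h : HasDirDeriv F d q v) :
    HasDirDeriv (fun p => conj (F p)) (conj d) q v :=
  h.clm_comp conjCLE.toContinuousLinearMap

theorem pi {ι : Type*} [Fintype ι] {F : E → ι → G} {d : ι → G}
    (h : ∀ i, HasDirDeriv (fun p => F p i) (d i) q v) : HasDirDeriv F d q v := by
  have h1 : DifferentiableAt ℝ F q := differentiableAt_pi.2 fun i => (h i).1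
  refine ⟨h1, funext fun i => ?_⟩
  rw [← (h i).2, fderiv_apply h1]
  rfl

theorem apply {ι : Type*} [Fintype ι] {F : E → ι → G} {d : ι → G}
    (h : HasDirDeriv F d q v) (i : ι) : HasDirDeriv (fun p => F p i) (d i) q v :=
  h.clm_comp (ContinuousLinearMap.proj (R := ℝ) (φ := fun _ : ι => G) i)

theorem star {ι : Type*} [Fintype ι] {F : E → ι → ℂ} {d : ι → ℂ}
    (h : HasDirDeriv F d q v) : HasDirDeriv (fun p => star (F p)) (star d) q v :=
  pi fun i => (h.apply i).complexConj

theorem pair {n : ℕ} {𝔸 : Type} [NormedCommRing 𝔸] [NormedAlgebra ℝ 𝔸]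
    {F F' : E → SpIdx n → 𝔸} {d d' : SpIdx n → 𝔸}
    (h : HasDirDeriv F d q v) (h' : HasDirDeriv F' d' q v) :
    HasDirDeriv (fun p => pair (F p) (F' p)) (CMap.pair d (F' q) + CMap.pair (F q) d') q v := by
  simp only [pair_eq_sum]
  refine congr_deriv (sum fun i _ => ((h.apply (Sum.inl i)).mul (h'.apply (Sum.inr i))).sub
    ((h.apply (Sum.inr i)).mul (h'.apply (Sum.inl i)))) ?_
  rw [← Finset.sum_add_distrib]
  exact Finset.sum_congr rfl fun i _ => by ring

theorem prodMk {H : Type*} [NormedAddCommGroup H] [NormedSpace ℝ H] {F : E → G} {F' : E → H}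
    {d : G} {d' : H} (h : HasDirDeriv F d q v) (h' : HasDirDeriv F' d' q v) :
    HasDirDeriv (fun p => (F p, F' p)) (d, d') q v := by
  rw [← h.2, ← h'.2]
  exact hasDirDeriv_of_hasFDerivAt (h.1.hasFDerivAt.prodMk h'.1.hasFDerivAt) v

theorem mulVec {ι κ 𝔸 : Type*} [Fintype ι] [Fintype κ] [NormedCommRing 𝔸] [NormedAlgebra ℝ 𝔸]
    {A : E → Matrix ι κ 𝔸} {A' : Matrix ι κ 𝔸} {F : E → κ → 𝔸} {d : κ → 𝔸}
    (hA : ∀ i j, HasDirDeriv (fun p => A p i j) (A' i j) q v) (h : HasDirDeriv F d q v) :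
    HasDirDeriv (fun p => A p *ᵥ F p) (A' *ᵥ F q + A q *ᵥ d) q v := by
  refine pi fun i => ?_
  simp only [Matrix.mulVec, dotProduct, Pi.add_apply]
  refine congr_deriv (sum fun j _ => (hA i j).mul (h.apply j)) ?_
  rw [Finset.sum_add_distrib]

theorem unique {F : E → G} {d d' : G} (h : HasDirDeriv F d q v) (h' : HasDirDeriv F d' q v) :
    d = d' := h.2.symm.trans h'.2

end HasDirDeriv

/-- A holomorphic function has its complex differential as real directional derivative. -/
theorem hasDirDeriv_of_holomorphic {n : ℕ} {G : Type*} [NormedAddCommGroup G] [NormedSpace ℂ G]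
    {F : (Fin n → ℂ) → G} {z : Fin n → ℂ} (h : DifferentiableAt ℂ F z) (v : Fin n → ℂ) :
    HasDirDeriv F (fderiv ℂ F z v) z v :=
  hasDirDeriv_of_hasFDerivAt (h.hasFDerivAt.restrictScalars ℝ) v

end DirDeriv

/-! ### Wirtinger derivatives as the complex-linear and antilinear parts of the real differential.
-/

section Wirtinger

variable {n : ℕ} {φ : (Fin n → ℂ) → ℂ} {z : Fin n → ℂ}

theorem single_I (i : Fin n) : (Pi.single i I : Fin n → ℂ) = I • Pi.single i 1 := by
  rw [← Pi.single_smul]; simp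

/-- `P` and `Q` are the complex-linear and antilinear parts of the differential. In the combination
of the directions 1 and i defining ∂_i the two `Q` contributions cancel and those of `P` add up. -/
theorem dWirt_eq {P Q : (Fin n → ℂ) → ℂ} (h : ∀ v, HasDirDeriv φ (P v + Q v) z v)
    (hP : ∀ v, P (I • v) = I * P v) (hQ : ∀ v, Q (I • v) = -I * Q v) (i : Fin n) :
    dWirt i φ z = P (Pi.single i 1) := by
  rw [dWirt, single_I, (h _).2, (h _).2, hP, hQ]
  linear_combination (1 / 2) * (Q (Pi.single i 1) - P (Pi.single i 1)) * I_sq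

theorem dWirtBar_eq {P Q : (Fin n → ℂ) → ℂ} (h : ∀ v, HasDirDeriv φ (P v + Q v) z v)
    (hP : ∀ v, P (I • v) = I * P v) (hQ : ∀ v, Q (I • v) = -I * Q v) (i : Fin n) :
    dWirtBar i φ z = Q (Pi.single i 1) := by
  rw [dWirtBar, single_I, (h _).2, (h _).2, hP, hQ]
  linear_combination (1 / 2) * (P (Pi.single i 1) - Q (Pi.single i 1)) * I_sq

theorem dWirt_of_differentiableAt (h : DifferentiableAt ℂ φ z) (i : Fin n) :
    dWirt i φ z = fderiv ℂ φ z (Pi.single i 1) :=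
  dWirt_eq (P := fun v => fderiv ℂ φ z v) (Q := fun _ => 0)
    (fun v => (hasDirDeriv_of_holomorphic h v).congr_deriv (by simp)) (by simp) (by simp) i

end Wirtinger

/-! ### Local special Kähler geometry: Kähler potential, covariant derivatives and metric. -/

namespace SpecialKahler

variable {n : ℕ} (S : SpecialKahler n)

/-- The derivative `∂_v Ω` of the holomorphic section. -/
def dSec (z v : Fin n → ℂ) : SpIdx n → ℂ := fderiv ℂ S.Ω z v

/-- The second derivative `∂_v ∂_w Ω` of the holomorphic section. -/
def d2Sec (z v w : Fin n → ℂ) : SpIdx n → ℂ := fderiv ℂ (fun y => fderiv ℂ S.Ω y w) z v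

/-- The positive real number `-i Ωᵀ ℂ Ω̄`. -/
def sqNorm (z : Fin n → ℂ) : ℝ := (-I * pair (S.Ω z) (star (S.Ω z))).re

/-- The derivative `v^i ∂_i 𝒦` of the Kähler potential. -/
def conn (z v : Fin n → ℂ) : ℂ := I * pair (S.dSec z v) (star (S.Ω z)) / S.sqNorm z

/-- `e^{𝒦/2}`. -/
def expK (z : Fin n → ℂ) : ℝ := Real.exp (kahlerPotential S.Ω z / 2)

/-- The covariant derivative `v^i ∇_i V`. -/
def covD (z v : Fin n → ℂ) : SpIdx n → ℂ :=
  (S.expK z : ℂ) • (S.dSec z v + S.conn z v • S.Ω z)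

/-- The Hermitian form `g_{ij*} v^i w̄^j`. -/
def herm (z v w : Fin n → ℂ) : ℂ := I * pair (S.covD z v) (star (S.covD z w))

theorem V_eq (z : Fin n → ℂ) : S.V z = (S.expK z : ℂ) • S.Ω z := rfl

variable {S} {z : Fin n → ℂ}

theorem differentiableAt_Ω (hz : z ∈ S.dom) : DifferentiableAt ℂ S.Ω z :=
  S.holo.differentiableAt (S.isOpen_dom.mem_nhds hz)

theorem hasDirDeriv_Ω (hz : z ∈ S.dom) (v : Fin n → ℂ) :
    HasDirDeriv S.Ω (S.dSec z v) z v :=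
  hasDirDeriv_of_holomorphic (differentiableAt_Ω hz) v

theorem hasDirDeriv_dSec (hz : z ∈ S.dom) (v w : Fin n → ℂ) :
    HasDirDeriv (fun y => S.dSec y w) (S.d2Sec z v w) z v :=
  hasDirDeriv_of_holomorphic (differentiableAt_fderiv_apply S.isOpen_dom S.holo hz w) v

theorem d2Sec_symm (hz : z ∈ S.dom) (v w : Fin n → ℂ) : S.d2Sec z v w = S.d2Sec z w v :=
  fderiv_fderiv_symm S.isOpen_dom S.holo hz w v

theorem dWirt_Ω (hz : z ∈ S.dom) (i : Fin n) (α : SpIdx n) :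
    dWirt i (fun w => S.Ω w α) z = S.dSec z (Pi.single i 1) α := by
  have h := differentiableAt_Ω hz
  rw [dWirt_of_differentiableAt (differentiableAt_pi.1 h α), fderiv_apply h]
  rfl

theorem dSec_add (z v w : Fin n → ℂ) : S.dSec z (v + w) = S.dSec z v + S.dSec z w := by
  simp [dSec]

theorem dSec_smul (z : Fin n → ℂ) (c : ℂ) (v : Fin n → ℂ) :
    S.dSec z (c • v) = c • S.dSec z v := by
  simp [dSec]

theorem sqNorm_pos (hz : z ∈ S.dom) : 0 < S.sqNorm z := S.pos z hz

theorem sqNorm_ne_zero (hz : z ∈ S.dom) : (S.sqNorm z : ℂ) ≠ 0 :=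
  ofReal_ne_zero.2 (sqNorm_pos hz).ne'

/-- Conjugation exchanges the two arguments and antisymmetry restores the order with a sign, so the
pairing is imaginary. -/
theorem pair_Ω_star (z : Fin n → ℂ) : pair (S.Ω z) (star (S.Ω z)) = I * S.sqNorm z := by
  have h := conj_pair (S.Ω z) (star (S.Ω z))
  rw [star_star, pair_swap (star (S.Ω z))] at h
  have hre : (pair (S.Ω z) (star (S.Ω z))).re = 0 := by
    have := congrArg Complex.re h
    simp at this
    linarith
  apply Complex.ext <;> simp [sqNorm, hre]

theorem pair_dSec_star (hz : z ∈ S.dom) (v : Fin n → ℂ) :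
    pair (S.dSec z v) (star (S.Ω z)) = -I * S.conn z v * S.sqNorm z := by
  rw [conn]
  field_simp [sqNorm_ne_zero hz]
  linear_combination pair (S.dSec z v) (star (S.Ω z)) * I_sq

theorem pair_star_dSec (hz : z ∈ S.dom) (v : Fin n → ℂ) :
    pair (S.Ω z) (star (S.dSec z v)) = -I * conj (S.conn z v) * S.sqNorm z := by
  have h := congrArg conj (pair_dSec_star hz v)
  rw [conj_pair, star_star, pair_swap] at h
  simp only [map_mul, map_neg, conj_I, conj_ofReal] at h
  linear_combination -h

theorem conn_add (z v w : Fin n → ℂ) : S.conn z (v + w) = S.conn z v + S.conn z w := by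
  simp only [conn, dSec_add, pair_add_left]; ring

theorem conn_smul (z : Fin n → ℂ) (c : ℂ) (v : Fin n → ℂ) :
    S.conn z (c • v) = c * S.conn z v := by
  simp only [conn, dSec_smul, pair_smul_left]; ring

theorem covD_add (z v w : Fin n → ℂ) : S.covD z (v + w) = S.covD z v + S.covD z w := by
  simp only [covD, dSec_add, conn_add]; module

theorem covD_smul (z : Fin n → ℂ) (c : ℂ) (v : Fin n → ℂ) :
    S.covD z (c • v) = c • S.covD z v := by
  simp only [covD, dSec_smul, conn_smul]; module

/-- A complex-linear function is determined by its values on the standard basis. -/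
theorem sum_smul_single {M : Type*} [AddCommGroup M] [Module ℂ M] {L : (Fin n → ℂ) → M}
    (hadd : ∀ v w, L (v + w) = L v + L w) (hsmul : ∀ (c : ℂ) v, L (c • v) = c • L v)
    (v : Fin n → ℂ) : ∑ i, v i • L (Pi.single i 1) = L v := by
  let L' : (Fin n → ℂ) →ₗ[ℂ] M := { toFun := L, map_add' := hadd, map_smul' := hsmul }
  have := L'.pi_apply_eq_sum_univ v
  rw [show L v = L' v from rfl, this]
  refine Finset.sum_congr rfl fun i _ => ?_
  congr 2
  ext j
  simp [Pi.single_apply, eq_comm]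

theorem sum_conn (z v : Fin n → ℂ) : ∑ i, v i * S.conn z (Pi.single i 1) = S.conn z v :=
  sum_smul_single (conn_add z) (conn_smul z) v

theorem sum_covD (z v : Fin n → ℂ) : ∑ i, v i • S.covD z (Pi.single i 1) = S.covD z v :=
  sum_smul_single (covD_add z) (covD_smul z) v

theorem hasDirDeriv_sqNorm_ofReal (hz : z ∈ S.dom) (v : Fin n → ℂ) :
    HasDirDeriv (fun y => (S.sqNorm y : ℂ)) (-(S.conn z v + conj (S.conn z v)) * S.sqNorm z)
      z v := by
  have h : ∀ y, (S.sqNorm y : ℂ) = -I * pair (S.Ω y) (star (S.Ω y)) := fun y => by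
    rw [pair_Ω_star]; linear_combination (S.sqNorm y : ℂ) * I_sq
  simp_rw [h]
  refine (((hasDirDeriv_Ω hz v).pair (hasDirDeriv_Ω hz v).star).const_mul (-I)).congr_deriv ?_
  rw [pair_dSec_star hz, pair_star_dSec hz, pair_Ω_star]
  ring_nf

theorem hasDirDeriv_sqNorm (hz : z ∈ S.dom) (v : Fin n → ℂ) :
    HasDirDeriv S.sqNorm (-(2 * (S.conn z v).re) * S.sqNorm z) z v := by
  refine (hasDirDeriv_sqNorm_ofReal hz v).re.congr_deriv ?_
  simp; ring

theorem hasDirDeriv_potential (hz : z ∈ S.dom) (v : Fin n → ℂ) :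
    HasDirDeriv (kahlerPotential S.Ω) (2 * (S.conn z v).re) z v := by
  have h := (hasDirDeriv_sqNorm hz v).scomp (Real.hasDerivAt_log (sqNorm_pos hz).ne')
  refine h.neg.congr_deriv ?_
  field_simp [(sqNorm_pos hz).ne']

theorem hasDirDeriv_potential_ofReal (hz : z ∈ S.dom) (v : Fin n → ℂ) :
    HasDirDeriv (fun y => (kahlerPotential S.Ω y : ℂ)) (S.conn z v + conj (S.conn z v)) z v :=
  (hasDirDeriv_potential hz v).ofReal.congr_deriv (by rw [add_conj])

theorem hasDirDeriv_expK (hz : z ∈ S.dom) (v : Fin n → ℂ) :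
    HasDirDeriv S.expK ((S.conn z v).re * S.expK z) z v := by
  have h := ((hasDirDeriv_potential hz v).mul_const (1 / 2)).scomp
    (Real.hasDerivAt_exp (kahlerPotential S.Ω z * (1 / 2)))
  simp only [mul_one_div] at h
  refine h.congr_deriv ?_
  rw [expK]; ring

theorem hasDirDeriv_expK_ofReal (hz : z ∈ S.dom) (v : Fin n → ℂ) :
    HasDirDeriv (fun y => (S.expK y : ℂ))
      ((1 / 2) * (S.conn z v + conj (S.conn z v)) * S.expK z) z v :=
  (hasDirDeriv_expK hz v).ofReal.congr_deriv (by rw [add_conj]; push_cast; ring)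

theorem expK_sq_mul_sqNorm (hz : z ∈ S.dom) : (S.expK z : ℂ) ^ 2 * S.sqNorm z = 1 := by
  have : S.expK z ^ 2 * S.sqNorm z = 1 := by
    have h : kahlerPotential S.Ω z = -Real.log (S.sqNorm z) := rfl
    rw [expK, ← Real.exp_nat_mul, h]
    push_cast
    rw [mul_div_cancel₀ _ two_ne_zero, Real.exp_neg, Real.exp_log (sqNorm_pos hz),
      inv_mul_cancel₀ (sqNorm_pos hz).ne']
  exact_mod_cast this

theorem dKahler_eq (hz : z ∈ S.dom) (i : Fin n) :
    dKahler S.Ω i z = S.conn z (Pi.single i 1) :=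
  dWirt_eq (P := S.conn z) (Q := fun v => conj (S.conn z v)) (hasDirDeriv_potential_ofReal hz)
    (conn_smul z I) (fun v => by simp [conn_smul]) i

theorem dKahlerBar_eq (hz : z ∈ S.dom) (i : Fin n) :
    dKahlerBar S.Ω i z = conj (S.conn z (Pi.single i 1)) :=
  dWirtBar_eq (P := S.conn z) (Q := fun v => conj (S.conn z v)) (hasDirDeriv_potential_ofReal hz)
    (conn_smul z I) (fun v => by simp [conn_smul]) i

/-- The factor e^{𝒦/2} contributes ½(∂_v𝒦 + conj ∂_v𝒦)V, whereas `covD` absorbs a full ∂_v𝒦 V. What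
is left is the phase rotation of V by the Kähler connection. -/
theorem hasDirDeriv_V (hz : z ∈ S.dom) (v : Fin n → ℂ) :
    HasDirDeriv S.V (S.covD z v + ((1 / 2) * (conj (S.conn z v) - S.conn z v)) • S.V z) z v := by
  have h := (hasDirDeriv_expK_ofReal hz v).smul (hasDirDeriv_Ω hz v)
  refine HasDirDeriv.congr_deriv h ?_
  rw [covD, V_eq]
  module

theorem nablaV_eq (hz : z ∈ S.dom) (i : Fin n) :
    S.nablaV i z = S.covD z (Pi.single i 1) := by
  ext α
  have h : dWirt i (fun w => S.V w α) z = S.covD z (Pi.single i 1) α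
      - (1 / 2) * S.conn z (Pi.single i 1) * S.V z α :=
    dWirt_eq (P := fun v => S.covD z v α - (1 / 2) * S.conn z v * S.V z α)
      (Q := fun v => (1 / 2) * conj (S.conn z v) * S.V z α)
      (fun v => ((hasDirDeriv_V hz v).apply α).congr_deriv (by
        simp only [Pi.add_apply, Pi.smul_apply, smul_eq_mul]; ring))
      (fun v => by simp only [covD_smul, conn_smul, Pi.smul_apply, smul_eq_mul]; ring)
      (fun v => by simp only [conn_smul, map_mul, conj_I]; ring) i
  rw [nablaV, h, dKahler_eq hz]
  ring

/-! #### Symplectic products of `V` and its covariant derivatives -/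

theorem pair_V_star_V (hz : z ∈ S.dom) : pair (S.V z) (star (S.V z)) = I := by
  rw [V_eq, star_smul, pair_smul_left, pair_smul_right, pair_Ω_star]
  simp only [RCLike.star_def, conj_ofReal]
  linear_combination I * expK_sq_mul_sqNorm hz

theorem pair_dSec (hz : z ∈ S.dom) (v : Fin n → ℂ) : pair (S.Ω z) (S.dSec z v) = 0 := by
  rw [← sum_smul_single (L := fun v => pair (S.Ω z) (S.dSec z v))
    (fun v w => by rw [dSec_add, pair_add_right]) (fun c v => by
      rw [dSec_smul, pair_smul_right, smul_eq_mul])]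
  refine Finset.sum_eq_zero fun i _ => ?_
  have h := S.lagrangian z hz i
  simp only [dWirt_Ω hz] at h
  rw [h, smul_zero]

theorem pair_V_covD (hz : z ∈ S.dom) (v : Fin n → ℂ) : pair (S.V z) (S.covD z v) = 0 := by
  rw [V_eq, covD, pair_smul_left, pair_smul_right, pair_add_right, pair_smul_right, pair_self,
    pair_dSec hz]
  ring

/-- Of the three terms containing `conn`, the two cross terms each contribute the product with sign
+, the ⟨Ω, Ω̄⟩ term with sign -, and e^𝒦 times `sqNorm` is 1. -/
theorem herm_eq (hz : z ∈ S.dom) (v w : Fin n → ℂ) :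
    S.herm z v w = I * pair (S.dSec z v) (star (S.dSec z w)) / S.sqNorm z
      + S.conn z v * conj (S.conn z w) := by
  have hN := sqNorm_ne_zero hz
  have h := expK_sq_mul_sqNorm hz
  have hE : (S.expK z : ℂ) ^ 2 = 1 / S.sqNorm z := by rw [eq_div_iff hN, h]
  rw [herm, covD, covD]
  simp only [star_smul, star_add, pair_smul_left, pair_smul_right, pair_add_right, pair_add_left,
    pair_Ω_star, pair_dSec_star hz, pair_star_dSec hz, RCLike.star_def, conj_ofReal]
  linear_combination (I * pair (S.dSec z v) (star (S.dSec z w))) * hE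
    + (S.conn z v * conj (S.conn z w)) * h
    - (S.conn z v * conj (S.conn z w) * (S.expK z : ℂ) ^ 2 * S.sqNorm z) * I_sq

theorem herm_add_left (z v v' w : Fin n → ℂ) :
    S.herm z (v + v') w = S.herm z v w + S.herm z v' w := by
  simp only [herm, covD_add, pair_add_left]; ring

theorem herm_smul_left (z : Fin n → ℂ) (c : ℂ) (v w : Fin n → ℂ) :
    S.herm z (c • v) w = c * S.herm z v w := by
  simp only [herm, covD_smul, pair_smul_left]; ring

theorem conj_herm (z v w : Fin n → ℂ) : conj (S.herm z v w) = S.herm z w v := by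
  rw [herm, herm, map_mul, conj_pair, star_star, conj_I, pair_swap]; ring

theorem sum_herm (z v w : Fin n → ℂ) :
    ∑ i, ∑ j, S.herm z (Pi.single i 1) (Pi.single j 1) * v i * conj (w j) = S.herm z v w := by
  have h1 : ∀ u, ∑ j, conj (w j) * S.herm z u (Pi.single j 1) = S.herm z u w := by
    intro u
    have := sum_smul_single (L := fun w => S.herm z w u)
      (fun v w => herm_add_left z v w u) (fun c v => herm_smul_left z c v u) w
    rw [← conj_herm, ← this, map_sum]
    exact Finset.sum_congr rfl fun j _ => by rw [smul_eq_mul, map_mul, conj_herm]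
  have h2 := sum_smul_single (L := fun v => S.herm z v w)
      (fun v v' => herm_add_left z v v' w) (fun c v => herm_smul_left z c v w) v
  rw [← h2]
  refine Finset.sum_congr rfl fun i _ => ?_
  rw [← h1, smul_eq_mul, Finset.mul_sum]
  exact Finset.sum_congr rfl fun j _ => by ring

/-- The part of the derivative of `∂_w 𝒦` in the direction `v` that is symmetric in `v`, `w`. -/
def hessK (S : SpecialKahler n) (z v w : Fin n → ℂ) : ℂ :=
  I * pair (S.d2Sec z v w) (star (S.Ω z)) / S.sqNorm z + S.conn z v * S.conn z w

theorem hessK_symm (hz : z ∈ S.dom) (v w : Fin n → ℂ) : S.hessK z v w = S.hessK z w v := by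
  rw [hessK, hessK, d2Sec_symm hz]; ring

theorem hasDirDeriv_sqNorm_inv (hz : z ∈ S.dom) (v : Fin n → ℂ) :
    HasDirDeriv (fun y => ((S.sqNorm y)⁻¹ : ℂ))
      ((S.conn z v + conj (S.conn z v)) / S.sqNorm z) z v := by
  have hN := (sqNorm_pos hz).ne'
  have h := ((hasDirDeriv_sqNorm hz v).scomp (hasDerivAt_inv hN)).ofReal
  simp only [ofReal_inv] at h
  refine h.congr_deriv ?_
  rw [add_conj]
  push_cast
  field_simp

/-- The part linear in `v` inherits symmetry from the second derivatives of Ω, and the antilinear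
part is the metric. This separation serves both to identify `kahlerMetric` and to compute the
curvature, where the symmetric part drops out. -/
theorem hasDirDeriv_conn (hz : z ∈ S.dom) (v w : Fin n → ℂ) :
    HasDirDeriv (fun y => S.conn y w) (S.hessK z v w + S.herm z w v) z v := by
  have h := (((hasDirDeriv_dSec hz v w).pair (hasDirDeriv_Ω hz v).star).const_mul I).mul
    (hasDirDeriv_sqNorm_inv hz v)
  refine HasDirDeriv.congr_deriv h ?_
  have hN' := sqNorm_ne_zero hz
  rw [hessK, herm_eq hz, pair_dSec_star hz]
  field_simp
  linear_combination (-(S.conn z v + conj (S.conn z v)) * S.conn z w * S.sqNorm z) * I_sq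

/-- ∂_{j*}𝒦 is the conjugate of `conn`. Conjugation makes `hessK` antilinear in `v`, hence invisible
to ∂_i, and turns `herm` into the complex-linear part. -/
theorem kahlerMetric_eq (hz : z ∈ S.dom) (i j : Fin n) :
    kahlerMetric S.Ω z i j = S.herm z (Pi.single i 1) (Pi.single j 1) := by
  refine dWirt_eq (P := fun v => S.herm z v (Pi.single j 1))
    (Q := fun v => conj (S.hessK z v (Pi.single j 1))) (fun v => ?_)
    (fun v => herm_smul_left z I v _) (fun v => ?_) i
  · refine ((hasDirDeriv_conn hz v (Pi.single j 1)).complexConj.congr_deriv ?_).congr_of_eventuallyEq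
      (Filter.eventually_of_mem (S.isOpen_dom.mem_nhds hz) fun y hy => dKahlerBar_eq hy j)
    rw [map_add, conj_herm, add_comm]
  · rw [← conj_I, ← map_mul]
    congr 1
    simp only [hessK, conn_smul, d2Sec, map_smul, pair_smul_left]
    ring

theorem sum_kahlerMetric (hz : z ∈ S.dom) (v w : Fin n → ℂ) :
    ∑ i, ∑ j, kahlerMetric S.Ω z i j * v i * conj (w j) = S.herm z v w := by
  simp only [kahlerMetric_eq hz, sum_herm]

theorem herm_pos (hz : z ∈ S.dom) {v : Fin n → ℂ} (hv : v ≠ 0) : 0 < (S.herm z v v).re := by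
  rw [← sum_kahlerMetric hz]; exact S.metric_pos z hz v hv

/-- Differentiability of `∇_w V`. -/
theorem hasDirDeriv_covD (hz : z ∈ S.dom) (v w : Fin n → ℂ) :
    HasDirDeriv (fun y => S.covD y w)
      (((1 / 2) * (S.conn z v + conj (S.conn z v))) • S.covD z w
        + (S.expK z : ℂ) • (S.d2Sec z v w + (S.hessK z v w + S.herm z w v) • S.Ω z
          + S.conn z w • S.dSec z v)) z v := by
  have h := (hasDirDeriv_expK_ofReal hz v).smul ((hasDirDeriv_dSec hz v w).add
    ((hasDirDeriv_conn hz v w).smul (hasDirDeriv_Ω hz v)))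
  refine HasDirDeriv.congr_deriv h ?_
  rw [covD]
  module

end SpecialKahler

/-! ### Differentiability of matrix inverses, and complexification of real matrices. -/

section MatrixCalculus

variable {E 𝔸 ι : Type*} [NormedAddCommGroup E] [NormedSpace ℝ E] [Fintype ι] [DecidableEq ι]
  [NormedField 𝔸] [NormedAlgebra ℝ 𝔸] {z : E}

theorem differentiableAt_mul_entry {ι' κ κ' : Type*} [Fintype κ] {A : E → Matrix ι' κ 𝔸}
    {B : E → Matrix κ κ' 𝔸}
    (hA : ∀ i j, DifferentiableAt ℝ (fun y => A y i j) z)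
    (hB : ∀ i j, DifferentiableAt ℝ (fun y => B y i j) z) (i : ι') (j : κ') :
    DifferentiableAt ℝ (fun y => (A y * B y) i j) z := by
  simp only [Matrix.mul_apply]
  exact DifferentiableAt.fun_sum fun l _ => (hA i l).mul (hB l j)

theorem differentiableAt_det {A : E → Matrix ι ι 𝔸}
    (hA : ∀ i j, DifferentiableAt ℝ (fun y => A y i j) z) :
    DifferentiableAt ℝ (fun y => (A y).det) z := by
  simp only [Matrix.det_apply']
  refine DifferentiableAt.fun_sum fun σ _ => ?_
  exact (differentiableAt_const _).mul 
    (HasFDerivAt.finsetProd fun i _ => (hA (σ i) i).hasFDerivAt).differentiableAt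

theorem differentiableAt_inv_entry {A : E → Matrix ι ι 𝔸}
    (hA : ∀ i j, DifferentiableAt ℝ (fun y => A y i j) z) (h0 : (A z).det ≠ 0) (i j : ι) :
    DifferentiableAt ℝ (fun y => (A y)⁻¹ i j) z := by
  simp only [Matrix.inv_def, Ring.inverse_eq_inv', Matrix.smul_apply, smul_eq_mul,
    Matrix.adjugate_apply]
  refine ((differentiableAt_det hA).inv h0).mul (differentiableAt_det fun k l => ?_)
  -- A cofactor is the determinant of the matrix whose row `j` is replaced by a constant unit
  -- vector.
  by_cases hk : k = j
  · subst hk; simp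
  · simpa [Matrix.updateRow_ne hk] using hA k l

end MatrixCalculus

/-- A real matrix regarded as a complex one. -/
abbrev matC {ι κ : Type*} (A : Matrix ι κ ℝ) : Matrix ι κ ℂ := A.map fun t : ℝ => (t : ℂ)

section Complexification

variable {ι κ : Type*} [Fintype κ]

theorem matC_mulVec_ofReal (A : Matrix ι κ ℝ) (x : κ → ℝ) :
    matC A *ᵥ (fun i => (x i : ℂ)) = fun i => ((A *ᵥ x) i : ℂ) := by
  ext i; simp [mulVec, dotProduct]

theorem star_matC_mulVec (A : Matrix ι κ ℝ) (x : κ → ℂ) :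
    star (matC A *ᵥ x) = matC A *ᵥ star x := by
  ext i; simp [mulVec, dotProduct]

theorem matC_mul {μ : Type*} (A : Matrix ι κ ℝ) (B : Matrix κ μ ℝ) :
    matC (A * B) = matC A * matC B := by
  ext i j; simp [Matrix.mul_apply]

end Complexification

/-! ### The period matrix and the characterisation of ℳ₄⁻¹. -/

namespace SpecialKahler

variable {n : ℕ} {S : SpecialKahler n} {z : Fin n → ℂ}

/-- The combination `c^i ∇_i V + c^{n+1} V̄`. -/
def frame (S : SpecialKahler n) (z : Fin n → ℂ) (c : Fin (n + 1) → ℂ) : SpIdx n → ℂ :=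
  S.covD z (fun i => c i.castSucc) + c (Fin.last n) • star (S.V z)

theorem fMat_mulVec (hz : z ∈ S.dom) (c : Fin (n + 1) → ℂ) :
    S.fMat z *ᵥ c = S.frame z c ∘ Sum.inl := by
  ext Λ
  rw [frame, ← sum_covD z]
  simp only [mulVec, dotProduct, fMat, Matrix.of_apply, Fin.sum_univ_castSucc, Fin.snoc_castSucc,
    Fin.snoc_last, Function.comp_apply, Pi.add_apply, nablaV_eq hz,
    Finset.sum_apply, Pi.smul_apply, smul_eq_mul, Pi.star_apply, RCLike.star_def, mul_comm]

theorem hMat_mulVec (hz : z ∈ S.dom) (c : Fin (n + 1) → ℂ) :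
    S.hMat z *ᵥ c = S.frame z c ∘ Sum.inr := by
  ext Λ
  rw [frame, ← sum_covD z]
  simp only [mulVec, dotProduct, hMat, Matrix.of_apply, Fin.sum_univ_castSucc, Fin.snoc_castSucc,
    Fin.snoc_last, Function.comp_apply, Pi.add_apply, nablaV_eq hz,
    Finset.sum_apply, Pi.smul_apply, smul_eq_mul, Pi.star_apply, RCLike.star_def, mul_comm]

/-- For the Hermitian form i⟨u, ū⟩ the ∇_iV are orthogonal to V̄. The form is the Kähler metric on
the former and |c|² on the latter, because ⟨V̄, V⟩ = -i. This definiteness is the source of the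
invertibility of f and of Im 𝒩. -/
theorem frame_pos (hz : z ∈ S.dom) {c : Fin (n + 1) → ℂ} (hc : c ≠ 0) :
    0 < (I * pair (S.frame z c) (star (S.frame z c))).re := by
  have h1 : pair (star (S.V z)) (S.V z) = -I := by rw [pair_swap, pair_V_star_V hz]
  have h2 : ∀ v, pair (S.covD z v) (S.V z) = 0 := fun v => by
    rw [pair_swap, pair_V_covD hz, neg_zero]
  have h3 : ∀ v, pair (star (S.V z)) (star (S.covD z v)) = 0 := fun v => by
    rw [← conj_pair, pair_V_covD hz, map_zero]
  have key : I * pair (S.frame z c) (star (S.frame z c)) =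
      S.herm z (fun i => c i.castSucc) (fun i => c i.castSucc)
        + (Complex.normSq (c (Fin.last n)) : ℂ) := by
    simp only [frame, star_add, star_smul, star_star, pair_add_left, pair_add_right,
      pair_smul_left, pair_smul_right, h1, h2, h3, herm, ← Complex.mul_conj, RCLike.star_def]
    linear_combination (-c (Fin.last n) * conj (c (Fin.last n))) * I_sq
  rw [key, add_re, ofReal_re]
  by_cases h : (fun i => c (Fin.castSucc i)) = 0
  · have hl : c (Fin.last n) ≠ 0 := fun hl => hc <| funext fun i => by
      induction i using Fin.lastCases with
      | last => exact hl
      | cast i => exact congrFun h i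
    have h0 : S.herm z 0 0 = 0 := by simpa using herm_smul_left z 0 0 (0 : Fin n → ℂ)
    rw [h, h0, zero_re, zero_add]
    exact Complex.normSq_pos.2 hl
  · exact add_pos_of_pos_of_nonneg (herm_pos hz h) (Complex.normSq_nonneg _)

/-- The pairing couples upper halves to lower halves only, so a vector of the span with vanishing
upper half would have zero norm. -/
theorem det_fMat_ne_zero (hz : z ∈ S.dom) : (S.fMat z).det ≠ 0 := by
  intro h
  obtain ⟨c, hc, h0⟩ := Matrix.exists_mulVec_eq_zero_iff.2 h
  have hpos := frame_pos hz hc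
  have h1 : ∀ i, S.frame z c (Sum.inl i) = 0 := fun i => by
    have := congrFun (fMat_mulVec hz c) i
    rw [h0] at this
    exact this.symm
  rw [pair_eq_sum] at hpos
  simp [h1] at hpos

theorem hMat_eq (hz : z ∈ S.dom) :
    S.hMat z = (matC (S.reN z) - I • matC (S.imN z)) * S.fMat z := by
  have h : matC (S.reN z) - I • matC (S.imN z) = S.hMat z * (S.fMat z)⁻¹ := by
    ext i j
    have e := conj_conj ((S.hMat z * (S.fMat z)⁻¹) i j)
    simp only [reN, imN, periodMatrix, Matrix.sub_apply, Matrix.smul_apply, Matrix.map_apply,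
      smul_eq_mul]
    apply Complex.ext <;> simp
  rw [h, Matrix.mul_assoc, Matrix.nonsing_inv_mul _ (det_fMat_ne_zero hz).isUnit, Matrix.mul_one]

/-- The lower half of a vector in the span of `∇_i V`, `V̄` is `𝒩̄` times its upper half. -/
theorem frame_inr (hz : z ∈ S.dom) (c : Fin (n + 1) → ℂ) :
    S.frame z c ∘ Sum.inr = matC (S.reN z) *ᵥ (S.frame z c ∘ Sum.inl)
      - I • (matC (S.imN z) *ᵥ (S.frame z c ∘ Sum.inl)) := by
  rw [← hMat_mulVec hz, ← fMat_mulVec hz, hMat_eq hz, ← mulVec_mulVec, sub_mulVec, smul_mulVec]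

theorem exists_frame_inl (hz : z ∈ S.dom) (x : Fin (n + 1) → ℂ) :
    ∃ c, S.frame z c ∘ Sum.inl = x := by
  refine ⟨(S.fMat z)⁻¹ *ᵥ x, ?_⟩
  rw [← fMat_mulVec hz, mulVec_mulVec, Matrix.mul_nonsing_inv _ (det_fMat_ne_zero hz).isUnit,
    one_mulVec]

/-- If Im 𝒩 y = 0 with y real, the vector of the span with upper half y has the real lower half Re 𝒩
y. A real vector u has ⟨u, ū⟩ = ⟨u, u⟩ = 0, contradicting positivity. -/
theorem det_imN_ne_zero (hz : z ∈ S.dom) : (S.imN z).det ≠ 0 := by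
  intro h
  obtain ⟨y, hy, h0⟩ := Matrix.exists_mulVec_eq_zero_iff.2 h
  obtain ⟨c, hc⟩ := exists_frame_inl hz (fun i => (y i : ℂ))
  have hc0 : c ≠ 0 := by
    rintro rfl
    refine hy (funext fun i => ?_)
    have h1 : S.frame z 0 = 0 := by
      have : S.covD z 0 = 0 := by simpa using covD_smul z 0 (0 : Fin n → ℂ)
      change S.covD z 0 + (0 : ℂ) • _ = 0
      rw [this, zero_smul, add_zero]
    have := congrFun hc i
    rw [h1] at this
    simpa using this.symm
  have hr := frame_inr hz c
  rw [hc, matC_mulVec_ofReal, matC_mulVec_ofReal, h0] at hr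
  have hstar : star (S.frame z c) = S.frame z c := by
    ext α
    rcases α with i | i
    · have := congrFun hc i
      simp only [Function.comp_apply] at this
      simp [this]
    · have := congrFun hr i
      simp only [Function.comp_apply, Pi.sub_apply, Pi.smul_apply, Pi.zero_apply, ofReal_zero,
        smul_zero, sub_zero] at this
      simp [this]
  have hpos := frame_pos hz hc0
  rw [hstar, pair_self] at hpos
  simp at hpos

/-- Substituting the lower half (R - iJ)x of such a vector, with R = Re 𝒩 and J = Im 𝒩, the blocks
give Jx + iRx = i(R - iJ)x above and -ix below. This eigenvalue-type equation replaces the explicit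
formula for ℳ₄⁻¹ when it is differentiated along an isometry. -/
theorem matC_M4Inv_frame (hz : z ∈ S.dom) (c : Fin (n + 1) → ℂ) :
    matC (S.M4Inv z) *ᵥ S.frame z c = I • (spC n ℂ *ᵥ S.frame z c) := by
  have hJ : matC (S.imN z)⁻¹ * matC (S.imN z) = 1 := by
    rw [← matC_mul, Matrix.nonsing_inv_mul _ (det_imN_ne_zero hz).isUnit]
    exact Matrix.map_one _ ofReal_zero ofReal_one
  have hM : matC (S.M4Inv z) = Matrix.fromBlocks
      (matC (S.imN z) + matC (S.reN z) * matC (S.imN z)⁻¹ * matC (S.reN z))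
      (-(matC (S.reN z) * matC (S.imN z)⁻¹))
      (-(matC (S.imN z)⁻¹ * matC (S.reN z))) (matC (S.imN z)⁻¹) := by
    simp only [← matC_mul]
    rw [M4Inv, matC, Matrix.fromBlocks_map]
    congr 1 <;> ext <;> simp
  rw [hM, spC, fromBlocks_mulVec, fromBlocks_mulVec, frame_inr hz]
  generalize S.frame z c ∘ Sum.inl = x
  generalize matC (S.imN z)⁻¹ = Ji at *
  generalize matC (S.imN z) = J at *
  generalize matC (S.reN z) = R at *
  have hJx : ∀ x, Ji *ᵥ (J *ᵥ x) = x := fun x => by rw [mulVec_mulVec, hJ, one_mulVec]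
  have h1 : (J + R * Ji * R) *ᵥ x + -(R * Ji) *ᵥ (R *ᵥ x - I • (J *ᵥ x))
      = J *ᵥ x + I • (R *ᵥ x) := by
    simp only [add_mulVec, neg_mulVec, mulVec_sub, mulVec_smul, ← mulVec_mulVec, hJx]
    module
  have h2 : -(Ji * R) *ᵥ x + Ji *ᵥ (R *ᵥ x - I • (J *ᵥ x)) = -(I • x) := by
    simp only [neg_mulVec, mulVec_sub, mulVec_smul, ← mulVec_mulVec, hJx]
    module
  rw [h1, h2]
  ext α
  rcases α with i | i
  · simp only [Sum.elim_inl, Pi.add_apply, Pi.smul_apply, zero_mulVec, one_mulVec, Pi.sub_apply,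
      Pi.zero_apply, smul_eq_mul]
    linear_combination (J *ᵥ x) i * I_sq
  · simp [neg_mulVec]

/-- A real matrix annihilating all `∇_i V` and `V̄` is zero. -/
theorem eq_zero_of_matC_mulVec_frame (hz : z ∈ S.dom) {B : Matrix (SpIdx n) (SpIdx n) ℝ}
    (hB : ∀ c, matC B *ᵥ S.frame z c = 0) : B = 0 := by
  -- A vector of the span with real upper half y has real part (y, Ry) and imaginary part -(0, Jy).
  -- A real matrix annihilates both, and since J is invertible these parts span the whole real
  -- space.
  have key : ∀ y : Fin (n + 1) → ℝ,
      B *ᵥ Sum.elim y (S.reN z *ᵥ y) = 0 ∧ B *ᵥ Sum.elim 0 (S.imN z *ᵥ y) = 0 := by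
    intro y
    obtain ⟨c, hc⟩ := exists_frame_inl hz (fun i => (y i : ℂ))
    have hr := frame_inr hz c
    rw [hc, matC_mulVec_ofReal, matC_mulVec_ofReal] at hr
    have hu : S.frame z c = (fun α => ((Sum.elim y (S.reN z *ᵥ y) α : ℝ) : ℂ))
        - I • fun α => ((Sum.elim 0 (S.imN z *ᵥ y) α : ℝ) : ℂ) := by
      ext α
      rcases α with i | i
      · simpa using congrFun hc i
      · simpa using congrFun hr i
    have h := hB c
    rw [hu, mulVec_sub, mulVec_smul, matC_mulVec_ofReal, matC_mulVec_ofReal] at h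
    constructor <;> ext α
    · simpa using congrArg Complex.re (congrFun h α)
    · simpa using congrArg Complex.im (congrFun h α)
  have h2 : ∀ y : Fin (n + 1) → ℝ, B *ᵥ Sum.elim 0 y = 0 := fun y => by
    have := (key ((S.imN z)⁻¹ *ᵥ y)).2
    rwa [mulVec_mulVec, Matrix.mul_nonsing_inv _ (det_imN_ne_zero hz).isUnit, one_mulVec] at this
  have h1 : ∀ x : SpIdx n → ℝ, B *ᵥ x = 0 := fun x => by
    have e : x = Sum.elim (x ∘ Sum.inl) (S.reN z *ᵥ (x ∘ Sum.inl))
        + Sum.elim (0 : Fin (n + 1) → ℝ) (x ∘ Sum.inr - S.reN z *ᵥ (x ∘ Sum.inl)) := by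
      ext α; rcases α with i | i <;> simp
    rw [e, mulVec_add, (key _).1, h2, add_zero]
  exact Matrix.ext_of_mulVec_single fun i => by rw [h1, zero_mulVec]

theorem differentiableAt_fMat (hz : z ∈ S.dom) (i j : Fin (n + 1)) :
    DifferentiableAt ℝ (fun y => S.fMat y i j) z := by
  induction j using Fin.lastCases with
  | last =>
    simp only [fMat, Matrix.of_apply, Fin.snoc_last]
    exact ((hasDirDeriv_V hz 0).apply (Sum.inl i)).complexConj.1
  | cast j =>
    simp only [fMat, Matrix.of_apply, Fin.snoc_castSucc]
    exact ((hasDirDeriv_covD hz 0 (Pi.single j 1)).apply (Sum.inl i)).1.congr_of_eventuallyEq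
      (Filter.eventually_of_mem (S.isOpen_dom.mem_nhds hz) fun y hy => 
        congrFun (nablaV_eq hy j) _)

theorem differentiableAt_hMat (hz : z ∈ S.dom) (i j : Fin (n + 1)) :
    DifferentiableAt ℝ (fun y => S.hMat y i j) z := by
  induction j using Fin.lastCases with
  | last =>
    simp only [hMat, Matrix.of_apply, Fin.snoc_last]
    exact ((hasDirDeriv_V hz 0).apply (Sum.inr i)).complexConj.1
  | cast j =>
    simp only [hMat, Matrix.of_apply, Fin.snoc_castSucc]
    exact ((hasDirDeriv_covD hz 0 (Pi.single j 1)).apply (Sum.inr i)).1.congr_of_eventuallyEq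
      (Filter.eventually_of_mem (S.isOpen_dom.mem_nhds hz) fun y hy => 
        congrFun (nablaV_eq hy j) _)

theorem differentiableAt_periodMatrix (hz : z ∈ S.dom) (i j : Fin (n + 1)) :
    DifferentiableAt ℝ (fun y => S.periodMatrix y i j) z :=
  conjCLE.toContinuousLinearMap.differentiableAt.comp z
    (differentiableAt_mul_entry (differentiableAt_hMat hz)
      (differentiableAt_inv_entry (differentiableAt_fMat hz) (det_fMat_ne_zero hz)) i j)

theorem differentiableAt_M4Inv (hz : z ∈ S.dom) (α β : SpIdx n) :
    DifferentiableAt ℝ (fun y => S.M4Inv y α β) z := by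
  have hR : ∀ i j, DifferentiableAt ℝ (fun y => S.reN y i j) z := fun i j =>
    reCLM.differentiableAt.comp z (differentiableAt_periodMatrix hz i j)
  have hJ : ∀ i j, DifferentiableAt ℝ (fun y => S.imN y i j) z := fun i j =>
    imCLM.differentiableAt.comp z (differentiableAt_periodMatrix hz i j)
  have hI := differentiableAt_inv_entry hJ (det_imN_ne_zero hz)
  rcases α with i | i <;> rcases β with j | j
  · exact (hJ i j).add (differentiableAt_mul_entry (differentiableAt_mul_entry hR hI) hR i j)
  · exact (differentiableAt_mul_entry hR hI i j).neg
  · exact (differentiableAt_mul_entry hI hR i j).neg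
  · exact hI i j

end SpecialKahler

theorem toC_mulVec {n : ℕ} (T : Matrix (SpIdx n) (SpIdx n) ℝ) (x : SpIdx n → ℝ) :
    toC (T *ᵥ x) = matC T *ᵥ toC x := (matC_mulVec_ofReal T x).symm

theorem matC_spC (n : ℕ) : matC (spC n ℝ) = spC n ℂ := by
  rw [spC, matC, Matrix.fromBlocks_map, spC]
  congr 1 <;> ext i j <;> rcases eq_or_ne i j with rfl | h <;> simp [*]

/-! ### Isometries of the base: their action on V, on the metric and on ℳ₄⁻¹. -/

namespace SKIsometry

open SpecialKahler

variable {n : ℕ} {S : SpecialKahler n} (ξ : SKIsometry S) {z : Fin n → ℂ}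

/-- The derivative `∂_w k` of the holomorphic vector field. -/
def dk (z w : Fin n → ℂ) : Fin n → ℂ := fderiv ℂ ξ.k z w

/-- The derivative `∂_w f` of the holomorphic compensator. -/
def df (z w : Fin n → ℂ) : ℂ := fderiv ℂ ξ.f z w

/-- The function `k^i ∂_i 𝒦 + f`, which takes imaginary values. -/
def compensated (z : Fin n → ℂ) : ℂ :=
  I * pair (matC ξ.T *ᵥ S.Ω z) (star (S.Ω z)) / S.sqNorm z

theorem symplecticC : (matC ξ.T)ᵀ * spC n ℂ + spC n ℂ * matC ξ.T = 0 := by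
  have h := congrArg matC ξ.symplectic
  rw [← matC_spC, ← Matrix.transpose_map, ← matC_mul, ← matC_mul]
  ext i j
  simpa using congrFun (congrFun h i) j

theorem pair_T_left (x y : SpIdx n → ℂ) : pair (matC ξ.T *ᵥ x) y = -pair x (matC ξ.T *ᵥ y) :=
  pair_mulVec_left _ ξ.symplecticC x y

theorem hasDirDeriv_k (hz : z ∈ S.dom) (v : Fin n → ℂ) : HasDirDeriv ξ.k (ξ.dk z v) z v :=
  hasDirDeriv_of_holomorphic (ξ.holo_k.differentiableAt (S.isOpen_dom.mem_nhds hz)) v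

theorem hasDirDeriv_f (hz : z ∈ S.dom) (v : Fin n → ℂ) : HasDirDeriv ξ.f (ξ.df z v) z v :=
  hasDirDeriv_of_holomorphic (ξ.holo_f.differentiableAt (S.isOpen_dom.mem_nhds hz)) v

theorem dSec_k (hz : z ∈ S.dom) :
    S.dSec z (ξ.k z) = matC ξ.T *ᵥ S.Ω z + ξ.f z • S.Ω z := by
  rw [← sum_smul_single (L := fun v => S.dSec z v) (dSec_add z) (dSec_smul z)]
  ext α
  have h := ξ.action z hz α
  simp only [dWirt_Ω hz] at h
  simpa [Finset.sum_apply] using h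

/-- Obtained by differentiating k^i ∂_iΩ = TΩ + fΩ along `w` and solving for the second-derivative
term, whose arguments are exchanged by symmetry. -/
theorem d2Sec_k (hz : z ∈ S.dom) (w : Fin n → ℂ) :
    S.d2Sec z (ξ.k z) w = matC ξ.T *ᵥ S.dSec z w + ξ.df z w • S.Ω z + ξ.f z • S.dSec z w
      - S.dSec z (ξ.dk z w) := by
  have hT : HasDirDeriv (fun y => matC ξ.T *ᵥ S.Ω y) (matC ξ.T *ᵥ S.dSec z w) z w :=
    (HasDirDeriv.mulVec (A' := 0) (fun _ _ => HasDirDeriv.const _)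
      (hasDirDeriv_Ω hz w)).congr_deriv (by rw [zero_mulVec, zero_add])
  have hR := hT.add ((ξ.hasDirDeriv_f hz w).smul (hasDirDeriv_Ω hz w))
  have hk := ξ.holo_k.differentiableAt (S.isOpen_dom.mem_nhds hz)
  have hd := differentiableAt_fderiv S.isOpen_dom S.holo hz
  have hL := hasDirDeriv_of_holomorphic (hd.clm_apply hk) w
  rw [fderiv_clm_apply hd hk] at hL
  have hL' := (hL.congr_of_eventuallyEq (F' := fun y => matC ξ.T *ᵥ S.Ω y + ξ.f y • S.Ω y)
    (Filter.eventually_of_mem (S.isOpen_dom.mem_nhds hz) fun y hy => (ξ.dSec_k hy).symm))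
  have h := hR.unique hL'
  have e : S.d2Sec z (ξ.k z) w = fderiv ℂ (fderiv ℂ S.Ω) z w (ξ.k z) := by
    rw [d2Sec_symm hz, d2Sec, fderiv_clm_apply hd (differentiableAt_const _)]
    simp
  rw [e, eq_sub_iff_add_eq]
  simp only [_root_.add_apply, ContinuousLinearMap.comp_apply,
    ContinuousLinearMap.flip_apply] at h
  rw [add_comm]
  exact h.symm.trans (by abel)

theorem conn_k (hz : z ∈ S.dom) : S.conn z (ξ.k z) = ξ.compensated z - ξ.f z := by
  have hN := sqNorm_ne_zero hz
  rw [conn, dSec_k ξ hz, pair_add_left, pair_smul_left, pair_Ω_star, compensated]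
  field_simp
  linear_combination ξ.f z * S.sqNorm z * I_sq

/-- T is real and symplectic, so ⟨TΩ, Ω̄⟩ is real and the factor i makes the quotient imaginary.
Together with `conn_k` this yields k(𝒦) = -f - f̄. -/
theorem conj_compensated (z : Fin n → ℂ) : conj (ξ.compensated z) = -ξ.compensated z := by
  rw [compensated, map_div₀, map_mul, conj_pair, star_star, conj_I, conj_ofReal,
    star_matC_mulVec, pair_swap, pair_T_left]
  ring

theorem kahlerMoment_eq (hz : z ∈ S.dom) : ξ.kahlerMoment z = -I * ξ.compensated z := by
  have h1 : ∑ i, ξ.k z i * dKahler S.Ω i z = S.conn z (ξ.k z) := by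
    simp only [dKahler_eq hz, sum_conn]
  have h2 : ∑ i, conj (ξ.k z i) * dKahlerBar S.Ω i z = conj (S.conn z (ξ.k z)) := by
    simp only [dKahlerBar_eq hz, ← map_mul, ← map_sum, sum_conn]
  have h3 : ξ.f z - conj (ξ.f z) = 2 * (ξ.f z).im * I := by
    rw [sub_conj]; push_cast; ring
  rw [kahlerMoment, h1, h2, conn_k ξ hz, map_sub, conj_compensated]
  linear_combination (I / 2) * h3 + ((ξ.f z).im : ℂ) * I_sq

/-- The statement ℓ_k ∂𝒦 = -∂f, the holomorphic part of the differential of k(𝒦) = -f - f̄. The `dk`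
term appears because `w` is held constant instead of being transported by k. -/
theorem hasDirDeriv_conn_k (hz : z ∈ S.dom) (w : Fin n → ℂ) :
    HasDirDeriv (fun y => S.conn y w) (-ξ.df z w - S.conn z (ξ.dk z w)) z (ξ.k z) := by
  have hN := sqNorm_ne_zero hz
  refine (hasDirDeriv_conn hz (ξ.k z) w).congr_deriv ?_
  rw [hessK, herm_eq hz, d2Sec_k ξ hz, dSec_k ξ hz]
  simp only [star_add, star_smul, pair_add_left, pair_add_right, pair_sub_left, pair_smul_left,
    pair_smul_right, pair_Ω_star, pair_dSec_star hz, star_matC_mulVec, pair_T_left,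
    conn_k ξ hz, map_sub, conj_compensated, RCLike.star_def]
  field_simp
  linear_combination (S.conn z (ξ.dk z w) + ξ.df z w - ξ.f z * S.conn z w
    - conj (ξ.f z) * S.conn z w) * S.sqNorm z * I_sq

/-- `∇V` along `k`. -/
theorem covD_k (hz : z ∈ S.dom) :
    S.covD z (ξ.k z) = matC ξ.T *ᵥ S.V z + ξ.compensated z • S.V z := by
  rw [covD, dSec_k ξ hz, conn_k ξ hz, V_eq, mulVec_smul]
  module

/-- The imaginary function `compensated` enters once through ∇_kV and once, with the opposite sign,
through the phase term. Only the rotation by i Im f survives. -/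
theorem hasDirDeriv_V_k (hz : z ∈ S.dom) :
    HasDirDeriv S.V (matC ξ.T *ᵥ S.V z + ((1 / 2) * (ξ.f z - conj (ξ.f z))) • S.V z)
      z (ξ.k z) := by
  refine (hasDirDeriv_V hz (ξ.k z)).congr_deriv ?_
  rw [covD_k ξ hz, conn_k ξ hz, map_sub, conj_compensated]
  module

theorem hasDirDeriv_covD_k (hz : z ∈ S.dom) (w : Fin n → ℂ) :
    HasDirDeriv (fun y => S.covD y w)
      (matC ξ.T *ᵥ S.covD z w + ((1 / 2) * (ξ.f z - conj (ξ.f z))) • S.covD z w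
        - S.covD z (ξ.dk z w)) z (ξ.k z) := by
  refine (hasDirDeriv_covD hz (ξ.k z) w).congr_deriv ?_
  have hc := (hasDirDeriv_conn hz (ξ.k z) w).unique (ξ.hasDirDeriv_conn_k hz w)
  rw [hc, d2Sec_k ξ hz, dSec_k ξ hz, conn_k ξ hz, map_sub, conj_compensated]
  simp only [covD, mulVec_smul, mulVec_add]
  module

/-- `d𝒫 = i g_{ij*} (dz^i k^{j*} - k^i dz̄^{j*})`. -/
theorem hasDirDeriv_kahlerMoment (hz : z ∈ S.dom) (v : Fin n → ℂ) :
    HasDirDeriv ξ.kahlerMoment (I * (S.herm z v (ξ.k z) - S.herm z (ξ.k z) v)) z v := by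
  have hN := sqNorm_ne_zero hz
  -- Since k(𝒦) + f equals i⟨TΩ, Ω̄⟩/`sqNorm`, differentiating it requires no derivative of k or f.
  have hE : HasDirDeriv (fun y => S.conn y (ξ.k y) + ξ.f y)
      (S.herm z (ξ.k z) v - S.herm z v (ξ.k z)) z v := by
    have hT : HasDirDeriv (fun y => matC ξ.T *ᵥ S.Ω y) (matC ξ.T *ᵥ S.dSec z v) z v :=
      (HasDirDeriv.mulVec (A' := 0) (fun _ _ => HasDirDeriv.const _)
        (hasDirDeriv_Ω hz v)).congr_deriv (by rw [zero_mulVec, zero_add])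
    have h := ((hT.pair (hasDirDeriv_Ω hz v).star).const_mul I).mul (hasDirDeriv_sqNorm_inv hz v)
    refine (h.congr_deriv ?_).congr_of_eventuallyEq
      (Filter.eventually_of_mem (S.isOpen_dom.mem_nhds hz) fun y hy => by
        show S.conn y (ξ.k y) + ξ.f y = _
        rw [ξ.conn_k hy, sub_add_cancel, compensated, div_eq_mul_inv])
    have hk : S.conn z (ξ.k z) = I * pair (matC ξ.T *ᵥ S.Ω z) (star (S.Ω z)) / S.sqNorm z
        - ξ.f z := ξ.conn_k hz
    have hk' : conj (S.conn z (ξ.k z)) =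
        -(I * pair (matC ξ.T *ᵥ S.Ω z) (star (S.Ω z)) / S.sqNorm z) - conj (ξ.f z) := by
      rw [ξ.conn_k hz, map_sub, conj_compensated, compensated]
    rw [herm_eq hz, herm_eq hz, dSec_k ξ hz, hk', hk]
    simp only [star_add, star_smul, pair_add_left, pair_add_right, pair_smul_left,
      pair_smul_right, pair_dSec_star hz, pair_star_dSec hz, star_matC_mulVec, pair_T_left,
      RCLike.star_def]
    field_simp
    ring_nf
    simp only [I_sq]
    ring
  refine ((hE.const_mul (-I)).congr_deriv (by ring)).congr_of_eventuallyEq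
    (Filter.eventually_of_mem (S.isOpen_dom.mem_nhds hz) fun y hy => ?_)
  show ξ.kahlerMoment y = -I * (S.conn y (ξ.k y) + ξ.f y)
  rw [ξ.kahlerMoment_eq hy, ξ.conn_k hy, sub_add_cancel]

/-- In i⟨∇_vV, conj ∇_wV⟩ the T terms cancel because T is symplectic, and the phase i Im f cancels
against its conjugate. The remaining terms come from holding `v` and `w` constant. -/
theorem herm_k_invariant (hz : z ∈ S.dom) (v w : Fin n → ℂ) :
    HasDirDeriv (fun y => S.herm y v w)
      (-S.herm z (ξ.dk z v) w - S.herm z v (ξ.dk z w)) z (ξ.k z) := by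
  have h := ((ξ.hasDirDeriv_covD_k hz v).pair (ξ.hasDirDeriv_covD_k hz w).star).const_mul I
  refine HasDirDeriv.congr_deriv h ?_
  simp only [herm, star_add, star_sub, star_smul, star_matC_mulVec, pair_add_left, pair_add_right,
    pair_sub_left, pair_sub_right, pair_smul_left, pair_smul_right, pair_T_left, RCLike.star_def,
    map_mul, map_sub, conj_conj, map_div₀, map_one, map_ofNat]
  ring

/-- Invariance of `ℳ₄⁻¹` under an isometry. -/
theorem M4Inv_invariant (hz : z ∈ S.dom) :
    (Matrix.of fun α β => fderiv ℝ (fun y => S.M4Inv y α β) z (ξ.k z))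
      + ξ.Tᵀ * S.M4Inv z + S.M4Inv z * ξ.T = 0 := by
  set M' : Matrix (SpIdx n) (SpIdx n) ℝ :=
    Matrix.of fun α β => fderiv ℝ (fun y => S.M4Inv y α β) z (ξ.k z) with hM'
  have hM : ∀ α β, HasDirDeriv (fun y => matC (S.M4Inv y) α β) (matC M' α β) z (ξ.k z) :=
    fun α β => HasDirDeriv.ofReal ⟨differentiableAt_M4Inv hz α β, rfl⟩
  refine eq_zero_of_matC_mulVec_frame hz fun c => ?_
  set s : ℂ := (1 / 2) * (ξ.f z - conj (ξ.f z)) with hs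
  obtain ⟨c', hu⟩ : ∃ c', HasDirDeriv (fun y => S.frame y c)
      (matC ξ.T *ᵥ S.frame z c + S.frame z c') z (ξ.k z) := by
    -- The ∇_iV rotate by the phase `s` and mix through -∂k. The last coefficient carries -s because
    -- V̄ rotates by conj s = -s.
    refine ⟨Fin.snoc (α := fun _ => ℂ) (fun i => s * c i.castSucc
      - ξ.dk z (fun i => c i.castSucc) i) (-s * c (Fin.last n)), ?_⟩
    have h := (ξ.hasDirDeriv_covD_k hz (fun i => c i.castSucc)).add
      ((HasDirDeriv.const (c (Fin.last n))).smul (ξ.hasDirDeriv_V_k hz).star)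
    refine HasDirDeriv.congr_deriv h ?_
    have hs' : conj s = -s := by
      simp only [hs, map_mul, map_sub, conj_conj, map_div₀, map_one, map_ofNat]; ring
    have e : S.covD z (fun i => s * c i.castSucc - ξ.dk z (fun i => c i.castSucc) i)
        = s • S.covD z (fun i => c i.castSucc) - S.covD z (ξ.dk z fun i => c i.castSucc) := by
      rw [← covD_smul, sub_eq_add_neg, ← neg_one_smul ℂ (S.covD z (ξ.dk z _)), ← covD_smul,
        ← covD_add]
      congr 1
      ext i
      simp [sub_eq_add_neg]
    simp only [← hs]
    simp only [frame, Fin.snoc_castSucc, Fin.snoc_last, e, star_add, star_smul,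
      star_matC_mulVec, mulVec_add, mulVec_smul, RCLike.star_def, hs']
    module
  have hL := HasDirDeriv.mulVec hM hu
  have hR : HasDirDeriv (fun y => I • (spC n ℂ *ᵥ S.frame y c))
      (I • (spC n ℂ *ᵥ (matC ξ.T *ᵥ S.frame z c + S.frame z c'))) z (ξ.k z) := by
    have h := (HasDirDeriv.const (q := z) (v := ξ.k z) I).smul (HasDirDeriv.mulVec
      (A := fun _ => spC n ℂ) (A' := 0) (fun _ _ => HasDirDeriv.const _) hu)
    refine HasDirDeriv.congr_deriv h ?_
    rw [zero_mulVec, zero_add, zero_smul, zero_add]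
  -- Both sides of ℳ₄⁻¹u = iℂu are differentiated along k. The contributions of the extra vector of
  -- the span agree by the same equation and cancel, leaving M'u + ℳ₄⁻¹Tu = iℂTu = -Tᵀ(iℂu) =
  -- -Tᵀℳ₄⁻¹u.
  have h := hL.unique (hR.congr_of_eventuallyEq
    (Filter.eventually_of_mem (S.isOpen_dom.mem_nhds hz) fun y hy => matC_M4Inv_frame hy c))
  rw [mulVec_add, mulVec_add, smul_add, matC_M4Inv_frame hz, ← add_assoc, add_left_inj] at h
  have hC : spC n ℂ *ᵥ (matC ξ.T *ᵥ S.frame z c)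
      = -((matC ξ.T)ᵀ *ᵥ (spC n ℂ *ᵥ S.frame z c)) := by
    rw [mulVec_mulVec, mulVec_mulVec, ← neg_mulVec,
      eq_neg_of_add_eq_zero_right ξ.symplecticC]
  have hexp : matC (M' + ξ.Tᵀ * S.M4Inv z + S.M4Inv z * ξ.T)
      = matC M' + (matC ξ.T)ᵀ * matC (S.M4Inv z) + matC (S.M4Inv z) * matC ξ.T := by
    rw [← Matrix.transpose_map, ← matC_mul, ← matC_mul]
    ext i j; simp
  rw [hexp, add_mulVec, add_mulVec, ← mulVec_mulVec, ← mulVec_mulVec, matC_M4Inv_frame hz,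
    mulVec_smul, add_right_comm, h, hC, smul_neg, neg_add_cancel]

end SKIsometry

/-- A family of linear functionals on a finite-dimensional space is differentiable if it is
pointwise. -/
theorem differentiableAt_of_forall_apply {E F G : Type*} [NormedAddCommGroup E] [NormedSpace ℝ E]
    [NormedAddCommGroup F] [NormedSpace ℝ F] [FiniteDimensional ℝ F]
    [NormedAddCommGroup G] [NormedSpace ℝ G] {α : E → F →L[ℝ] G} {q : E}
    (h : ∀ X, DifferentiableAt ℝ (fun p => α p X) q) : DifferentiableAt ℝ α q := by
  let b : (Fin (Module.finrank ℝ F) → ℝ) ≃L[ℝ] F :=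
    ContinuousLinearEquiv.ofFinrankEq (by simp)
  let g : (F →L[ℝ] G) ≃L[ℝ] (Fin (Module.finrank ℝ F) → G) :=
    (b.symm.arrowCongr (ContinuousLinearEquiv.refl ℝ G)).trans
      (ContinuousLinearEquiv.piRing (𝕜 := ℝ) (E := G) (Fin (Module.finrank ℝ F)))
  rw [← g.comp_differentiableAt_iff, differentiableAt_pi]
  exact fun i => h (b (Pi.single i 1))

/-! ### Differential forms and directional derivatives on the coordinate space. -/

variable {n : ℕ}

/-- Evaluated on constant vector fields, which commute, the exterior derivative has no bracket term.
-/
theorem extD_eq {α : Coord n → Covec n} {q : Coord n} {d : Coord n → Coord n → ℂ}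
    (h : ∀ X Y, HasDirDeriv (fun p => α p Y) (d X Y) q X) (X Y : Coord n) :
    extD α q X Y = d X Y - d Y X := by
  have hd : DifferentiableAt ℝ α q := differentiableAt_of_forall_apply fun X => (h 0 X).1
  have hd' : DifferentiableAt ℝ (fun p =>
      ContinuousAlternatingMap.ofSubsingleton ℝ (Coord n) ℂ (0 : Fin 1) (α p)) q :=
    (ContinuousAlternatingMap.ofSubsingletonLIE (𝕜 := ℝ) (E := Coord n)
      (F := ℂ) (0 : Fin 1)).toContinuousLinearEquiv.differentiableAt.comp q hd
  rw [extD, extDeriv_apply hd', Fin.sum_univ_two, ← (h X Y).2, ← (h Y X).2]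
  simp [Fin.removeNth, sub_eq_add_neg]

/-! ### Values of the coordinate forms -/

/-- The projection to the special Kähler coordinates. -/
def czL (n : ℕ) : Coord n →L[ℝ] (Fin n → ℂ) :=
  ContinuousLinearMap.fst ℝ (Fin n → ℂ) (SpIdx n → ℝ) ∘L
    ContinuousLinearMap.snd ℝ ℝ _ ∘L ContinuousLinearMap.snd ℝ ℝ _

/-- The projection to the coordinates `Z`. -/
def cZL (n : ℕ) : Coord n →L[ℝ] (SpIdx n → ℝ) :=
  ContinuousLinearMap.snd ℝ (Fin n → ℂ) (SpIdx n → ℝ) ∘L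
    ContinuousLinearMap.snd ℝ ℝ _ ∘L ContinuousLinearMap.snd ℝ ℝ _

theorem dU_apply (X : Coord n) : dU X = (cU X : ℂ) := rfl
theorem da_apply (X : Coord n) : da X = (ca X : ℂ) := rfl
theorem dz_apply (i : Fin n) (X : Coord n) : dz i X = cz X i := rfl
theorem dzBar_apply (i : Fin n) (X : Coord n) : dzBar i X = conj (cz X i) := rfl
theorem dZ_apply (α : SpIdx n) (X : Coord n) : dZ α X = toC (cZ X) α := rfl

theorem pairInvdZ_apply (w : SpIdx n → ℂ) (X : Coord n) :
    pairInvdZ w X = -pair w (toC (cZ X)) := by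
  have h : pairInvdZ w X = (w ᵥ* spCInv n ℂ) ⬝ᵥ toC (cZ X) := by
    simp [pairInvdZ, dotProduct, dZ_apply]
  rw [h, ← dotProduct_mulVec, spCInv_eq_neg, neg_mulVec, dotProduct_neg, pair]

theorem formPhi_apply (q X : Coord n) :
    formPhi q X = ca X - pair (toC (cZ q)) (toC (cZ X)) := by
  rw [formPhi, _root_.add_apply, pairInvdZ_apply, da_apply, sub_eq_add_neg]

theorem conj_formPhi (q X : Coord n) : conj (formPhi q X) = formPhi q X := by
  rw [formPhi_apply, map_sub, conj_pair, conj_ofReal, star_toC, star_toC]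

theorem formdS_apply (q X : Coord n) :
    formdS q X = cU X + I * cexpR (-cU q) * formPhi q X := by
  simp [formdS, dU_apply]

theorem formdSBar_apply (q X : Coord n) :
    formdSBar q X = cU X - I * cexpR (-cU q) * formPhi q X := by
  simp [formdSBar, dU_apply]

theorem sum_spCInv (x y : SpIdx n → ℂ) :
    ∑ α, ∑ β, spCInv n ℂ α β * (x α * y β) = -pair x y := by
  rw [pair, ← dotProduct_neg, ← neg_mulVec, ← spCInv_eq_neg]
  simp only [dotProduct, mulVec, Finset.mul_sum]
  exact Finset.sum_congr rfl fun α _ => Finset.sum_congr rfl fun β _ => by ring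

theorem sum_spCInv_wedge (θ : SpIdx n → Covec n) (X Y : Coord n) :
    ∑ α, ∑ β, spCInv n ℂ α β * wedge (θ α) (dZ β) X Y
      = pair (fun α => θ α Y) (toC (cZ X)) - pair (fun α => θ α X) (toC (cZ Y)) := by
  simp only [wedge, dZ_apply, mul_sub, Finset.sum_sub_distrib, sum_spCInv]
  ring

/-- Makes e^{-U} and e^{-U/2} powers of a single atom, so that `ring` can compare them. -/
theorem cexpR_eq_sq (t : ℝ) : cexpR t = cexpR (t / 2) ^ 2 := by
  rw [cexpR, cexpR, ← ofReal_pow, ← Real.exp_nat_mul]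
  congr 2
  push_cast; ring

theorem conj_cexpR (t : ℝ) : conj (cexpR t) = cexpR t := conj_ofReal _

theorem cexpR_ne_zero (t : ℝ) : cexpR t ≠ 0 := ofReal_ne_zero.2 (Real.exp_pos t).ne'

section CoordDeriv

variable {q X : Coord n}

theorem HasDirDeriv.comp_cz {G : Type*} [NormedAddCommGroup G] [NormedSpace ℝ G]
    {F : (Fin n → ℂ) → G} {d : G} (h : HasDirDeriv F d (cz q) (cz X)) :
    HasDirDeriv (fun p : Coord n => F (cz p)) d q X :=
  HasDirDeriv.comp_clm (czL n) h

theorem hasDirDeriv_cZ : HasDirDeriv (fun p : Coord n => cZ p) (cZ X) q X :=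
  HasDirDeriv.clm (cZL n)

theorem hasDirDeriv_toC_cZ : HasDirDeriv (fun p : Coord n => toC (cZ p)) (toC (cZ X)) q X :=
  HasDirDeriv.pi fun i => (hasDirDeriv_cZ.apply i).ofReal

theorem hasDirDeriv_exp (c : ℝ) :
    HasDirDeriv (fun p : Coord n => Real.exp (c * cU p)) (c * cU X * Real.exp (c * cU q)) q X := by
  have h : HasDirDeriv (fun p : Coord n => cU p) (cU X) q X :=
    HasDirDeriv.clm (ContinuousLinearMap.fst ℝ ℝ (ℝ × (Fin n → ℂ) × (SpIdx n → ℝ)))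
  refine ((h.const_mul c).scomp (Real.hasDerivAt_exp _)).congr_deriv ?_
  ring

theorem hasDirDeriv_cexpR :
    HasDirDeriv (fun p : Coord n => cexpR (-cU p)) (-cU X * cexpR (-cU q)) q X := by
  have h := (hasDirDeriv_exp (q := q) (X := X) (-1)).ofReal
  simp only [neg_one_mul] at h
  exact h.congr_deriv (by simp [cexpR])

theorem hasDirDeriv_cexpR_half :
    HasDirDeriv (fun p : Coord n => cexpR (-cU p / 2))
      (-(1 / 2) * cU X * cexpR (-cU q / 2)) q X := by
  have h := (hasDirDeriv_exp (q := q) (X := X) (-(1 / 2))).ofReal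
  have e : ∀ p : Coord n, -(1 / 2) * cU p = -cU p / 2 := fun p => by ring
  simp only [e] at h
  refine h.congr_deriv ?_
  rw [cexpR]; push_cast; ring

theorem hasDirDeriv_formPhi (Y : Coord n) :
    HasDirDeriv (fun p : Coord n => formPhi p Y) (-pair (toC (cZ X)) (toC (cZ Y))) q X := by
  simp only [formPhi_apply]
  refine ((HasDirDeriv.const _).sub (hasDirDeriv_toC_cZ.pair (HasDirDeriv.const _))).congr_deriv ?_
  rw [pair_zero_right]; ring

end CoordDeriv

/-! ### The forms of the c-map expressed through `conn`, `covD` and `herm`. -/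

namespace SpecialKahler

variable {S : SpecialKahler n} {q : Coord n}

theorem QM_mem_nhds (hq : q ∈ S.QM) : S.QM ∈ nhds q :=
  (S.isOpen_dom.preimage (czL n).continuous).mem_nhds hq

theorem connQ_apply (hq : q ∈ S.QM) (X : Coord n) :
    S.connQ q X = (I / 2) * (S.conn (cz q) (cz X) - conj (S.conn (cz q) (cz X))) := by
  have hz : cz q ∈ S.dom := hq
  have h1 := sum_conn (S := S) (cz q) (cz X)
  have h2 := congrArg conj h1
  simp only [map_sum, map_mul] at h2
  rw [← h2, ← h1]
  simp [connQ, dKahler_eq hz, dKahlerBar_eq hz, dz_apply, dzBar_apply, mul_comm]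

theorem DV_apply (hq : q ∈ S.QM) (X : Coord n) :
    (fun α => S.DV q α X) = S.covD (cz q) (cz X) := by
  ext α
  rw [← sum_covD]
  simp [DV, nablaV_eq (S := S) (z := cz q) hq, dz_apply, Finset.sum_apply, mul_comm]

theorem kahlerForm_apply (hq : q ∈ S.QM) (X Y : Coord n) :
    S.kahlerForm q X Y
      = (I / 2) * (S.herm (cz q) (cz X) (cz Y) - S.herm (cz q) (cz Y) (cz X)) := by
  rw [kahlerForm, ← sum_kahlerMetric hq, ← sum_kahlerMetric hq, ← Finset.sum_sub_distrib]
  congr 1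
  refine Finset.sum_congr rfl fun i _ => ?_
  rw [← Finset.sum_sub_distrib]
  refine Finset.sum_congr rfl fun j _ => ?_
  rw [wedge, dz_apply, dz_apply, dzBar_apply, dzBar_apply]
  ring

theorem formu_apply (hq : q ∈ S.QM) (X Y : Coord n) :
    S.formu q X Y = -(1 / 2) * (S.herm (cz q) (cz X) (cz Y) - S.herm (cz q) (cz Y) (cz X))
      + (I / 4) * cexpR (-cU q) * (cU X * formPhi q Y - cU Y * formPhi q X)
      - cexpR (-cU q) * (pair (S.V (cz q)) (toC (cZ X)) * pair (star (S.V (cz q))) (toC (cZ Y))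
        - pair (S.V (cz q)) (toC (cZ Y)) * pair (star (S.V (cz q))) (toC (cZ X)))
      + (I / 2) * cexpR (-cU q) * pair (toC (cZ X)) (toC (cZ Y)) := by
  have h := sum_spCInv_wedge (fun α => dZ α) X Y
  have e : ∀ W : Coord n, (fun α => dZ α W) = toC (cZ W) := fun W => rfl
  rw [e, e, pair_swap (toC (cZ Y))] at h
  rw [formu, h, kahlerForm_apply hq]
  simp only [wedge, formdS_apply, formdSBar_apply, pairInvdZ_apply]
  linear_combination (1 / 2 * (S.herm (cz q) (cz X) (cz Y) - S.herm (cz q) (cz Y) (cz X))) * I_sq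

theorem formv_apply (hq : q ∈ S.QM) (X Y : Coord n) :
    S.formv q X Y = cexpR (-cU q / 2) *
      (pair (S.covD (cz q) (cz Y)) (toC (cZ X)) - pair (S.covD (cz q) (cz X)) (toC (cZ Y))
        + (1 / 2) * (formdS q X * pair (S.V (cz q)) (toC (cZ Y))
          - formdS q Y * pair (S.V (cz q)) (toC (cZ X)))) := by
  rw [formv, sum_spCInv_wedge, DV_apply hq, DV_apply hq]
  simp only [wedge, pairInvdZ_apply]
  ring

/-! ### The connection and its curvature -/

/-- The diagonal entry of the connection. -/
theorem omega_zero_zero (hq : q ∈ S.QM) (X : Coord n) : S.omega q 0 0 X =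
    (1 / 4) * (S.conn (cz q) (cz X) - conj (S.conn (cz q) (cz X)))
      - (I / 4) * (cexpR (-cU q) * formPhi q X) := by
  simp only [omega, Matrix.of_apply, Matrix.cons_val_zero, _root_.sub_apply,
    _root_.smul_apply, smul_eq_mul, connQ_apply hq, Matrix.cons_val', Matrix.cons_val_fin_one]
  linear_combination (-(1 / 4) * (S.conn (cz q) (cz X) - conj (S.conn (cz q) (cz X)))) * I_sq

theorem omega_one_one (X : Coord n) : S.omega q 1 1 X = -S.omega q 0 0 X := by
  simp [omega]; ring

theorem omega_zero_one (X : Coord n) :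
    S.omega q 0 1 X = -(cexpR (-cU q / 2) * pair (S.V (cz q)) (toC (cZ X))) := by
  simp [omega, pairInvdZ_apply]

theorem omega_one_zero (X : Coord n) :
    S.omega q 1 0 X = cexpR (-cU q / 2) * pair (star (S.V (cz q))) (toC (cZ X)) := by
  simp [omega, pairInvdZ_apply]

theorem hasDirDeriv_omega_zero_zero (hq : q ∈ S.QM) (X Y : Coord n) :
    HasDirDeriv (fun p => S.omega p 0 0 Y)
      ((1 / 4) * (S.hessK (cz q) (cz X) (cz Y) + S.herm (cz q) (cz Y) (cz X)
          - conj (S.hessK (cz q) (cz X) (cz Y) + S.herm (cz q) (cz Y) (cz X)))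
        - (I / 4) * (-cU X * cexpR (-cU q) * formPhi q Y
          + cexpR (-cU q) * -pair (toC (cZ X)) (toC (cZ Y)))) q X := by
  have hc : HasDirDeriv (fun p : Coord n => S.conn (cz p) (cz Y)) _ q X :=
    HasDirDeriv.comp_cz (F := fun z => S.conn z (cz Y)) (hasDirDeriv_conn hq (cz X) (cz Y))
  exact (((hc.sub hc.complexConj).const_mul (1 / 4)).sub ((hasDirDeriv_cexpR.mul
    (hasDirDeriv_formPhi Y)).const_mul (I / 4))).congr_of_eventuallyEq
      (Filter.eventually_of_mem (QM_mem_nhds hq) fun p hp => omega_zero_zero hp Y)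

theorem hasDirDeriv_V_cz (hq : q ∈ S.QM) (X : Coord n) :
    HasDirDeriv (fun p : Coord n => S.V (cz p)) (S.covD (cz q) (cz X)
      + ((1 / 2) * (conj (S.conn (cz q) (cz X)) - S.conn (cz q) (cz X))) • S.V (cz q)) q X :=
  HasDirDeriv.comp_cz (hasDirDeriv_V hq (cz X))

theorem hasDirDeriv_omega_zero_one (hq : q ∈ S.QM) (X Y : Coord n) :
    HasDirDeriv (fun p => S.omega p 0 1 Y)
      (-(cexpR (-cU q / 2) * (-(1 / 2) * cU X * pair (S.V (cz q)) (toC (cZ Y))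
        + pair (S.covD (cz q) (cz X)) (toC (cZ Y))
        + (1 / 2) * (conj (S.conn (cz q) (cz X)) - S.conn (cz q) (cz X))
          * pair (S.V (cz q)) (toC (cZ Y))))) q X := by
  simp only [omega_zero_one]
  refine (hasDirDeriv_cexpR_half.mul ((hasDirDeriv_V_cz hq X).pair
    (HasDirDeriv.const _))).neg.congr_deriv ?_
  rw [pair_add_left, pair_smul_left, pair_zero_right]
  ring

theorem conj_omega_zero_one (X : Coord n) : conj (S.omega q 0 1 X) = -S.omega q 1 0 X := by
  rw [omega_zero_one, omega_one_zero, map_neg, map_mul, conj_pair, star_toC, conj_cexpR]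

theorem conj_omega_zero_zero (hq : q ∈ S.QM) (X : Coord n) :
    conj (S.omega q 0 0 X) = -S.omega q 0 0 X := by
  rw [omega_zero_zero hq]
  simp only [map_sub, map_mul, conj_formPhi, conj_cexpR, map_div₀, conj_I, conj_conj, map_one,
    map_ofNat]
  ring

/-- The symmetric `hessK` cancels in dω and `herm` leaves the Kähler form. Differentiating e^{-U}Φ
gives the dU ∧ Φ and dZ ∧ ℂ⁻¹dZ terms, and ω₀₁ ∧ ω₁₀ gives the term bilinear in V and V̄. -/
theorem curvK_zero_zero (hq : q ∈ S.QM) (X Y : Coord n) : S.curvK q X Y 0 0 = S.formu q X Y := by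
  rw [curvK, Matrix.of_apply, extD_eq (hasDirDeriv_omega_zero_zero hq), Fin.sum_univ_two,
    formu_apply hq, cexpR_eq_sq]
  simp only [wedge, omega_zero_one, omega_one_zero, map_add, conj_herm,
    hessK_symm (S := S) hq (cz Y) (cz X), pair_swap (toC (cZ Y)) (toC (cZ X))]
  ring

/-- The 𝒬 part of 2ω₀₀ ∧ ω₀₁ cancels the phase term in dV and leaves DV. The Φ part combines with
the dU produced by e^{-U/2} into dS. -/
theorem curvK_zero_one (hq : q ∈ S.QM) (X Y : Coord n) : S.curvK q X Y 0 1 = S.formv q X Y := by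
  rw [curvK, Matrix.of_apply, extD_eq (hasDirDeriv_omega_zero_one hq), Fin.sum_univ_two,
    formv_apply hq]
  simp only [wedge, omega_zero_one, omega_one_one, omega_zero_zero hq, formdS_apply]
  ring

/-- The connection is anti-Hermitian, so this entry follows from the opposite one by conjugation. -/
theorem curvK_one_zero (hq : q ∈ S.QM) (X Y : Coord n) :
    S.curvK q X Y 1 0 = -conj (S.formv q X Y) := by
  have h : ∀ X Y, HasDirDeriv (fun p => S.omega p 1 0 Y) _ q X := fun X Y => by
    have h := (hasDirDeriv_omega_zero_one hq X Y).complexConj.neg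
    simp only [conj_omega_zero_one, neg_neg] at h
    exact h
  rw [← curvK_zero_one hq, curvK, Matrix.of_apply, Matrix.of_apply, extD_eq h,
    extD_eq (hasDirDeriv_omega_zero_one hq)]
  have e : ∀ X, S.omega q 1 0 X = -conj (S.omega q 0 1 X) := fun X => by
    rw [conj_omega_zero_one, neg_neg]
  simp only [Fin.sum_univ_two, wedge, omega_one_one, e, map_add, map_sub, map_mul, map_neg,
    conj_omega_zero_zero hq]
  ring

theorem curvK_one_one (hq : q ∈ S.QM) (X Y : Coord n) : S.curvK q X Y 1 1 = -S.formu q X Y := by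
  have h : ∀ X Y, HasDirDeriv (fun p => S.omega p 1 1 Y) _ q X := fun X Y => by
    have h := (hasDirDeriv_omega_zero_zero hq X Y).neg
    simp only [← omega_one_one] at h
    exact h
  rw [← curvK_zero_zero hq, curvK, Matrix.of_apply, Matrix.of_apply, extD_eq h,
    extD_eq (hasDirDeriv_omega_zero_zero hq)]
  simp only [Fin.sum_univ_two, wedge, omega_one_one]
  ring

theorem curvK_eq (hq : q ∈ S.QM) (X Y : Coord n) : S.curvK q X Y =
    !![S.formu q X Y, S.formv q X Y; -conj (S.formv q X Y), -S.formu q X Y] := by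
  ext i j
  fin_cases i <;> fin_cases j
  · exact curvK_zero_zero hq X Y
  · exact curvK_zero_one hq X Y
  · exact curvK_one_zero hq X Y
  · exact curvK_one_one hq X Y

end SpecialKahler

theorem cU_mk (a b : ℝ) (c : Fin n → ℂ) (d : SpIdx n → ℝ) : cU (n := n) (a, b, c, d) = a := rfl
theorem ca_mk (a b : ℝ) (c : Fin n → ℂ) (d : SpIdx n → ℝ) : ca (n := n) (a, b, c, d) = b := rfl
theorem cz_mk (a b : ℝ) (c : Fin n → ℂ) (d : SpIdx n → ℝ) : cz (n := n) (a, b, c, d) = c := rfl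
theorem cZ_mk (a b : ℝ) (c : Fin n → ℂ) (d : SpIdx n → ℝ) : cZ (n := n) (a, b, c, d) = d := rfl

theorem toC_zero : toC (0 : SpIdx n → ℝ) = 0 := by ext; simp [toC]

theorem killHeis_eq (Λ : SpIdx n → ℝ) (q : Coord n) :
    killHeis Λ q = (0, pair Λ (cZ q), 0, Λ) := by
  rw [killHeis, spCInv_eq_neg, neg_mulVec, dotProduct_neg, neg_neg, pair]

namespace SpecialKahler

variable {S : SpecialKahler n} {z : Fin n → ℂ} {q : Coord n}

theorem covD_zero (z : Fin n → ℂ) : S.covD z 0 = 0 := by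
  simpa using covD_smul (S := S) z 0 (0 : Fin n → ℂ)

theorem conn_zero (z : Fin n → ℂ) : S.conn z 0 = 0 := by
  simpa using conn_smul (S := S) z 0 (0 : Fin n → ℂ)

theorem herm_zero_left (z w : Fin n → ℂ) : S.herm z 0 w = 0 := by
  rw [herm, covD_zero, pair_zero_left, mul_zero]

theorem herm_zero_right (z w : Fin n → ℂ) : S.herm z w 0 = 0 := by
  rw [← conj_herm, herm_zero_left, map_zero]

/-! ### Moment maps -/

/-- It suffices to check the moment map equation on the first row of an `su(2)`-valued function. -/
theorem isMomentMap_of {k : Coord n → Coord n} {P : Coord n → Matrix (Fin 2) (Fin 2) ℂ}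
    {p r : Coord n → ℂ} {dp dr : Coord n → Coord n → ℂ}
    (hP : ∀ q, P q = !![p q, r q; -conj (r q), -p q])
    (himag : ∀ q ∈ S.QM, conj (p q) = -p q)
    (hdp : ∀ q ∈ S.QM, ∀ X, HasDirDeriv p (dp q X) q X)
    (hdr : ∀ q ∈ S.QM, ∀ X, HasDirDeriv r (dr q X) q X)
    (hu : ∀ q ∈ S.QM, ∀ X, (1 / 2) * S.formu q X (k q)
      = dp q X - S.omega q 0 1 X * conj (r q) - r q * S.omega q 1 0 X)
    (hv : ∀ q ∈ S.QM, ∀ X, (1 / 2) * S.formv q X (k q)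
      = dr q X + 2 * S.omega q 0 0 X * r q - 2 * p q * S.omega q 0 1 X) :
    S.IsMomentMap k P := by
  obtain rfl : P = fun q => !![p q, r q; -conj (r q), -p q] := funext hP
  intro q hq
  have hd : ∀ X, ∀ i j : Fin 2, HasDirDeriv
      (fun p' => (!![p p', r p'; -conj (r p'), -p p'] : Matrix (Fin 2) (Fin 2) ℂ) i j)
      ((!![dp q X, dr q X; -conj (dr q X), -dp q X] : Matrix (Fin 2) (Fin 2) ℂ) i j) q X := by
    intro X i j
    fin_cases i <;> fin_cases j
    · exact hdp q hq X
    · exact hdr q hq X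
    · exact (hdr q hq X).complexConj.neg
    · exact (hdp q hq X).neg
  refine ⟨⟨?_, by simp [Matrix.trace_fin_two]⟩, fun i j => (hd 0 i j).1, fun X => ?_⟩
  · ext i j
    fin_cases i <;> fin_cases j <;> simp [himag q hq]
  · have hv' := congrArg conj (hv q hq X)
    simp only [map_mul, map_add, map_sub, himag q hq, conj_omega_zero_zero hq,
      conj_omega_zero_one, map_div₀, map_one, map_ofNat] at hv'
    have e : (Matrix.of fun i j => fderiv ℝ (fun p' => (!![p p', r p'; -conj (r p'), -p p'] :
        Matrix (Fin 2) (Fin 2) ℂ) i j) q X) = !![dp q X, dr q X; -conj (dr q X), -dp q X] := by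
      ext i j
      exact (hd X i j).2
    refine Eq.trans ?_ (congrArg (· + _) e.symm)
    rw [contractK, curvK_eq hq]
    ext i j
    simp only [Matrix.add_apply, Matrix.sub_apply, Matrix.smul_apply, Matrix.mul_apply,
      Fin.sum_univ_two, smul_eq_mul, omegaAt, Matrix.map_apply]
    fin_cases i <;> fin_cases j <;>
      simp only [Fin.zero_eta, Fin.mk_one, Matrix.of_apply, Matrix.cons_val_zero,
        Matrix.cons_val_one, Matrix.cons_val', Matrix.cons_val_fin_one, Fin.isValue, omega_one_one]
    · linear_combination hu q hq X
    · linear_combination hv q hq X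
    · linear_combination -hv'
    · linear_combination -hu q hq X

theorem isMomentMap_heis (Λ : SpIdx n → ℝ) : S.IsMomentMap (killHeis Λ) (S.momentHeis Λ) := by
  refine isMomentMap_of
    (p := fun q => -(I / 4) * (cexpR (-cU q) * pair (toC Λ) (toC (cZ q))))
    (r := fun q => (1 / 2) * (cexpR (-cU q / 2) * pair (toC Λ) (S.V (cz q))))
    (fun q => ?_) (fun q _ => ?_)
    (fun q _ X => (hasDirDeriv_cexpR.mul
      ((HasDirDeriv.const _).pair hasDirDeriv_toC_cZ)).const_mul _)
    (fun q hq X => (hasDirDeriv_cexpR_half.mul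
      ((HasDirDeriv.const _).pair (hasDirDeriv_V_cz hq X))).const_mul _)
    (fun q hq X => ?_) (fun q hq X => ?_)
  · rw [momentHeis]
    simp only [map_mul, conj_pair, star_toC, conj_cexpR, map_div₀, map_one, map_ofNat]
    congr 1
    ring_nf
  · simp only [map_mul, map_neg, map_div₀, conj_I, conj_pair, star_toC, conj_cexpR, map_ofNat]
    ring
  · rw [killHeis_eq, formu_apply hq]
    simp only [omega_zero_one, omega_one_zero, formPhi_apply, cU_mk, ca_mk, cz_mk, cZ_mk,
      herm_zero_left, herm_zero_right, map_mul, conj_pair, star_toC, conj_cexpR, map_div₀,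
      map_one, map_ofNat, pair_zero_left, ← pair_toC, pair_swap _ (toC Λ), ofReal_zero,
      cexpR_eq_sq (-cU q)]
    ring
  · rw [killHeis_eq, formv_apply hq]
    simp only [omega_zero_one, omega_zero_zero hq, formdS_apply, formPhi_apply, cU_mk, ca_mk,
      cz_mk, cZ_mk, covD_zero, pair_zero_left, ← pair_toC, pair_swap _ (toC Λ), ofReal_zero,
      pair_add_right, pair_smul_right, cexpR_eq_sq (-cU q)]
    ring

theorem isMomentMap_central : S.IsMomentMap killCentral momentCentral := by
  refine isMomentMap_of (p := fun q => -(I / 8) * cexpR (-cU q)) (r := fun _ => 0)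
    (fun q => ?_) (fun q _ => ?_) (fun q _ X => hasDirDeriv_cexpR.const_mul _)
    (fun q _ X => HasDirDeriv.const _) (fun q hq X => ?_) (fun q hq X => ?_)
  · rw [momentCentral]; simp
  · simp only [map_mul, map_neg, map_div₀, conj_I, conj_cexpR, map_ofNat]
    ring
  · rw [killCentral, formu_apply hq]
    simp only [formPhi_apply, cU_mk, ca_mk, cz_mk, cZ_mk, herm_zero_left, herm_zero_right,
      map_zero, toC_zero, pair_zero_right, ofReal_zero, ofReal_one]
    ring
  · rw [killCentral, formv_apply hq]
    simp only [omega_zero_one, formdS_apply, formPhi_apply, cU_mk, ca_mk, cz_mk, cZ_mk,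
      covD_zero, toC_zero, pair_zero_left, pair_zero_right, ofReal_zero, ofReal_one]
    ring

/-- On the diagonal, d𝒫 is the contraction of the Kähler form. Off the diagonal, ∇_kV = TV + cV, and
the cV term is matched by the commutator of ω with the 𝒫 = -ic part of the moment map. The terms in
Z agree because T is symplectic. -/
theorem isMomentMap_SK (ξ : SKIsometry S) : S.IsMomentMap (killSK ξ) (momentSK ξ) := by
  have hTZ : ∀ q X : Coord n, HasDirDeriv (fun p : Coord n => toC (ξ.T *ᵥ cZ p))
      (matC ξ.T *ᵥ toC (cZ X)) q X := fun q X => by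
    simp only [toC_mulVec]
    refine (HasDirDeriv.mulVec (A' := 0) (fun _ _ => HasDirDeriv.const _)
      hasDirDeriv_toC_cZ).congr_deriv ?_
    rw [zero_mulVec, zero_add]
  have hreal : ∀ q ∈ S.QM, conj (ξ.kahlerMoment (cz q)) = ξ.kahlerMoment (cz q) :=
    fun q hq => by
      rw [ξ.kahlerMoment_eq hq, map_mul, ξ.conj_compensated, map_neg, conj_I]; ring
  refine isMomentMap_of
    (p := fun q => (I / 4) * (ξ.kahlerMoment (cz q)
        + (1 / 2) * (cexpR (-cU q) * pair (toC (cZ q)) (toC (ξ.T *ᵥ cZ q)))))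
    (r := fun q => -(1 / 2) * (cexpR (-cU q / 2) * pair (S.V (cz q)) (toC (ξ.T *ᵥ cZ q))))
    (fun q => ?_) (fun q hq => ?_)
    (fun q hq X => ((HasDirDeriv.comp_cz (ξ.hasDirDeriv_kahlerMoment hq (cz X))).add
      ((hasDirDeriv_cexpR.mul (hasDirDeriv_toC_cZ.pair (hTZ q X))).const_mul _)).const_mul _)
    (fun q hq X => (hasDirDeriv_cexpR_half.mul
      ((hasDirDeriv_V_cz hq X).pair (hTZ q X))).const_mul _)
    (fun q hq X => ?_) (fun q hq X => ?_)
  · rw [momentSK]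
    simp only [map_mul, map_neg, conj_pair, star_toC, conj_cexpR, map_div₀, map_one, map_ofNat]
    congr 1
    ring_nf
  · simp only [map_mul, map_add, map_div₀, conj_I, conj_pair, star_toC, conj_cexpR, map_ofNat,
      map_one, hreal q hq]
    ring
  · rw [killSK, formu_apply hq]
    have h1 : pair (matC ξ.T *ᵥ toC (cZ q)) (toC (cZ X))
      = -pair (toC (cZ q)) (matC ξ.T *ᵥ toC (cZ X)) := ξ.pair_T_left _ _
    have h2 : pair (toC (cZ X)) (matC ξ.T *ᵥ toC (cZ q))
      = pair (toC (cZ q)) (matC ξ.T *ᵥ toC (cZ X)) := by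
      rw [pair_swap, h1, neg_neg]
    simp only [omega_zero_one, omega_one_zero, formPhi_apply, cU_mk, ca_mk, cz_mk, cZ_mk,
      toC_mulVec, map_mul, map_neg, conj_pair, star_toC, star_matC_mulVec, conj_cexpR, map_div₀,
      map_one, map_ofNat, h2, ofReal_zero, cexpR_eq_sq (-cU q)]
    linear_combination (-(1 / 4) * (S.herm (cz q) (cz X) (ξ.k (cz q))
      - S.herm (cz q) (ξ.k (cz q)) (cz X))) * I_sq
  · rw [killSK, formv_apply hq]
    simp only [omega_zero_one, omega_zero_zero hq, formdS_apply, formPhi_apply, cU_mk, ca_mk,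
      cz_mk, cZ_mk, toC_mulVec, ξ.covD_k hq, ξ.kahlerMoment_eq hq, pair_add_left, pair_smul_left,
      ξ.pair_T_left (S.V (cz q)), ofReal_zero, cexpR_eq_sq (-cU q)]
    linear_combination ((1 / 2) * cexpR (-cU q / 2) * ξ.compensated (cz q)
      * pair (S.V (cz q)) (toC (cZ X))) * I_sq

/-! ### Uniqueness of the moment map -/

theorem V_ne_zero (hz : z ∈ S.dom) : S.V z ≠ 0 := fun h => by
  have := pair_V_star_V hz
  rw [h, pair_zero_left] at this
  exact I_ne_zero this.symm

/-- A covariantly constant `su(2)`-valued function vanishes. -/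
theorem eq_zero_of_covariantlyConstant {D : Coord n → Matrix (Fin 2) (Fin 2) ℂ}
    (hskew : ∀ q ∈ S.QM, (D q)ᴴ = -D q) (htr : ∀ q ∈ S.QM, (D q).trace = 0)
    (hdiff : ∀ q ∈ S.QM, ∀ i j, DifferentiableAt ℝ (fun p => D p i j) q)
    (hD : ∀ q ∈ S.QM, ∀ X, (Matrix.of fun i j => fderiv ℝ (fun p => D p i j) q X)
      + (S.omegaAt q X * D q - D q * S.omegaAt q X) = 0) :
    ∀ q ∈ S.QM, D q = 0 := by
  have h11 : ∀ q ∈ S.QM, D q 1 1 = -D q 0 0 := fun q hq => by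
    have := htr q hq
    rw [Matrix.trace_fin_two] at this
    exact eq_neg_of_add_eq_zero_right this
  have hD01 : ∀ q ∈ S.QM, ∀ X, fderiv ℝ (fun p => D p 0 1) q X
      = 2 * S.omega q 0 1 X * D q 0 0 - 2 * S.omega q 0 0 X * D q 0 1 := by
    intro q hq X
    have h := congrFun (congrFun (hD q hq X) 0) 1
    simp only [Matrix.add_apply, Matrix.sub_apply, Matrix.mul_apply, Fin.sum_univ_two,
      Matrix.of_apply, omegaAt, Matrix.map_apply, omega_one_one, h11 q hq,
      Matrix.zero_apply] at h
    linear_combination h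
  -- No dU occurs in ω, so the (0, 1) entry is constant along the lines in the U direction, which
  -- stay in the domain.
  have hU : ∀ q ∈ S.QM, fderiv ℝ (fun p => D p 0 1) q ((1, 0, 0, 0) : Coord n) = 0 := by
    intro q hq
    rw [hD01 q hq, omega_zero_one, omega_zero_zero hq, formPhi_apply]
    simp only [cz_mk, cZ_mk, ca_mk, conn_zero, toC_zero, pair_zero_right, map_zero, ofReal_zero]
    ring
  have hmem : ∀ q ∈ S.QM, ∀ t : ℝ, q + t • ((1, 0, 0, 0) : Coord n) ∈ S.QM := by
    intro q hq t
    have e : cz (q + t • ((1, 0, 0, 0) : Coord n)) = cz q := by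
      show cz q + t • (0 : Fin n → ℂ) = cz q
      rw [smul_zero, add_zero]
    show cz (q + t • ((1, 0, 0, 0) : Coord n)) ∈ S.dom
    rw [e]; exact hq
  have hconst : ∀ q ∈ S.QM, D (q + (1, 0, 0, 0)) 0 1 = D q 0 1 := by
    intro q hq
    have hder : ∀ t : ℝ, HasDerivAt
        (fun t : ℝ => D (q + t • ((1, 0, 0, 0) : Coord n)) 0 1) 0 t := by
      intro t
      have hl : HasDerivAt (fun t : ℝ => q + t • ((1, 0, 0, 0) : Coord n)) (1, 0, 0, 0) t := by
        simpa using ((hasDerivAt_id t).smul_const ((1, 0, 0, 0) : Coord n)).const_add q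
      have h := (hdiff _ (hmem q hq t) 0 1).hasFDerivAt.comp_hasDerivAt t hl
      rw [hU _ (hmem q hq t)] at h
      exact h
    have h := is_const_of_deriv_eq_zero (fun t => (hder t).differentiableAt)
      (fun t => (hder t).deriv) 1 0
    simpa only [one_smul, zero_smul, add_zero] using h
  have h01 : ∀ q ∈ S.QM, D q 0 1 = 0 := by
    intro q hq
    have hq' : q + (1, 0, 0, 0) ∈ S.QM := by simpa using hmem q hq 1
    -- The a-derivatives at `q` and at its translate by one unit of U agree. They equal (i/2)e^{-U}
    -- times the same entry with two different values of e^{-U}, so the entry is zero. Comparing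
    -- translates avoids second derivatives of `D`.
    have hev : (fun p => D (p + (1, 0, 0, 0)) 0 1) =ᶠ[nhds q] fun p => D p 0 1 :=
      Filter.eventually_of_mem (QM_mem_nhds hq) hconst
    have h := hev.fderiv_eq (𝕜 := ℝ)
    rw [fderiv_comp_add_right (f := fun p => D p 0 1)] at h
    have h' := congrArg (fun L : Coord n →L[ℝ] ℂ => L (0, 1, 0, 0)) h
    have hE : cexpR (-cU (q + (1, 0, 0, 0))) ≠ cexpR (-cU q) := by
      have e : cU (q + (1, 0, 0, 0)) = cU q + 1 := rfl
      rw [e, cexpR, cexpR, Ne, ofReal_inj, Real.exp_eq_exp]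
      intro h; linarith
    simp only [hD01 q hq, hD01 _ hq', omega_zero_one, omega_zero_zero hq, omega_zero_zero hq',
      formPhi_apply, cz_mk, cZ_mk, ca_mk, conn_zero, toC_zero, pair_zero_right, map_zero,
      ofReal_one, hconst q hq] at h'
    have h2 : (cexpR (-cU (q + (1, 0, 0, 0))) - cexpR (-cU q)) * (I * D q 0 1) = 0 := by
      linear_combination 2 * h'
    rcases mul_eq_zero.1 h2 with h3 | h3
    · exact absurd (sub_eq_zero.1 h3) hE
    · exact (mul_eq_zero.1 h3).resolve_left I_ne_zero
  have h00 : ∀ q ∈ S.QM, D q 0 0 = 0 := by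
    intro q hq
    -- Along a direction Λ of Z that pairs nontrivially with V, the vanishing derivative of the (0,
    -- 1) entry equals a nonzero multiple of the diagonal entry.
    obtain ⟨Λ, hΛ⟩ := exists_pair_toC_ne_zero (V_ne_zero (S := S) hq)
    have hev : (fun p => D p 0 1) =ᶠ[nhds q] fun _ => (0 : ℂ) :=
      Filter.eventually_of_mem (QM_mem_nhds hq) h01
    have h := hD01 q hq (0, 0, 0, Λ)
    rw [hev.fderiv_eq, h01 q hq, omega_zero_one, cZ_mk] at h
    have h2 : cexpR (-cU q / 2) * pair (S.V (cz q)) (toC Λ) * D q 0 0 = 0 := by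
      simp only [fderiv_fun_const, Pi.zero_apply, _root_.zero_apply] at h
      linear_combination (1 / 2) * h
    exact (mul_eq_zero.1 h2).resolve_left (mul_ne_zero (cexpR_ne_zero _) hΛ)
  intro q hq
  have h10 : D q 1 0 = 0 := by
    have := congrFun (congrFun (hskew q hq) 1) 0
    simpa [h01 q hq] using this
  ext i j
  fin_cases i <;> fin_cases j
  · exact h00 q hq
  · exact h01 q hq
  · exact h10
  · exact (h11 q hq).trans (by rw [h00 q hq, neg_zero]; rfl)

theorem isMomentMap_unique {k : Coord n → Coord n} {P P' : Coord n → Matrix (Fin 2) (Fin 2) ℂ}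
    (h : S.IsMomentMap k P) (h' : S.IsMomentMap k P') (hq : q ∈ S.QM) : P q = P' q := by
  refine sub_eq_zero.1 (eq_zero_of_covariantlyConstant (S := S) (D := fun q => P q - P' q)
    (fun q hq => ?_) (fun q hq => ?_) (fun q hq i j => ?_) (fun q hq X => ?_) q hq)
  · rw [conjTranspose_sub, (h q hq).1.1, (h' q hq).1.1]; abel
  · rw [trace_sub, (h q hq).1.2, (h' q hq).1.2, sub_zero]
  · exact ((h q hq).2.1 i j).sub ((h' q hq).2.1 i j)
  · have e := ((h q hq).2.2 X).symm.trans ((h' q hq).2.2 X)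
    have e' : (Matrix.of fun i j => fderiv ℝ (fun p => (P p - P' p) i j) q X)
        = (Matrix.of fun i j => fderiv ℝ (fun p => P p i j) q X)
          - (Matrix.of fun i j => fderiv ℝ (fun p => P' p i j) q X) := by
      ext i j
      simp only [Matrix.of_apply, Matrix.sub_apply]
      rw [fderiv_fun_sub ((h q hq).2.1 i j) ((h' q hq).2.1 i j)]
      rfl
    rw [e', Matrix.mul_sub, Matrix.sub_mul]
    rw [← sub_eq_zero] at e
    rw [← e]
    abel

end SpecialKahler

namespace SpecialKahler

variable {S : SpecialKahler n} {z : Fin n → ℂ} {q : Coord n}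

/-! ### Killing vectors -/

theorem formPhi_re (q X : Coord n) : (formPhi q X).re = ca X - pair (cZ q) (cZ X) := by
  rw [formPhi_apply, pair_toC, ← ofReal_sub, ofReal_re]

theorem metric_eq (hq : q ∈ S.QM) (X Y : Coord n) : S.metric q X Y =
    (1 / 4) * (cU X * cU Y + 4 * (S.herm (cz q) (cz X) (cz Y)).re
      + Real.exp (-2 * cU q) *
        ((ca X - pair (cZ q) (cZ X)) * (ca Y - pair (cZ q) (cZ Y)))
      - 2 * (Real.exp (-1 * cU q) * (cZ X ⬝ᵥ (S.M4Inv (cz q) *ᵥ cZ Y)))) := by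
  rw [metric, sum_kahlerMetric hq, formPhi_re, formPhi_re, neg_one_mul]
  ring

/-- The derivative of the metric, in terms of the derivatives of `g_{ij*}` and `ℳ₄⁻¹`. -/
theorem hasDirDeriv_metric (hq : q ∈ S.QM) {W : Coord n} (X Y : Coord n) {h : ℂ}
    (hh : HasDirDeriv (fun y => S.herm y (cz X) (cz Y)) h (cz q) (cz W)) :
    HasDirDeriv (fun p => S.metric p X Y)
      ((1 / 4) * (4 * h.re
        + (-2 * cU W * Real.exp (-2 * cU q) *
            ((ca X - pair (cZ q) (cZ X)) * (ca Y - pair (cZ q) (cZ Y)))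
          - Real.exp (-2 * cU q) * (pair (cZ W) (cZ X) * (ca Y - pair (cZ q) (cZ Y))
            + (ca X - pair (cZ q) (cZ X)) * pair (cZ W) (cZ Y)))
        - 2 * (-1 * cU W * Real.exp (-1 * cU q) * (cZ X ⬝ᵥ (S.M4Inv (cz q) *ᵥ cZ Y))
          + Real.exp (-1 * cU q) * (cZ X ⬝ᵥ ((Matrix.of fun α β =>
            fderiv ℝ (fun y => S.M4Inv y α β) (cz q) (cz W)) *ᵥ cZ Y))))) q W := by
  have hPhi : ∀ X : Coord n, HasDirDeriv (fun p : Coord n => ca X - pair (cZ p) (cZ X))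
      (-pair (cZ W) (cZ X)) q W := fun X => by
    refine ((HasDirDeriv.const (ca X)).sub
      (hasDirDeriv_cZ.pair (HasDirDeriv.const (cZ X)))).congr_deriv ?_
    rw [pair_zero_right]; ring
  have hM : HasDirDeriv (fun p : Coord n => S.M4Inv (cz p) *ᵥ cZ Y)
      ((Matrix.of fun α β => fderiv ℝ (fun y => S.M4Inv y α β) (cz q) (cz W)) *ᵥ cZ Y) q W := by
    refine (HasDirDeriv.mulVec (A := fun p : Coord n => S.M4Inv (cz p)) (fun α β =>
      HasDirDeriv.comp_cz (F := fun y => S.M4Inv y α β) ⟨differentiableAt_M4Inv hq α β, rfl⟩)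
      (HasDirDeriv.const (cZ Y))).congr_deriv ?_
    rw [mulVec_zero, add_zero]
    rfl
  have hdot : HasDirDeriv (fun p : Coord n => cZ X ⬝ᵥ (S.M4Inv (cz p) *ᵥ cZ Y))
      (cZ X ⬝ᵥ ((Matrix.of fun α β => fderiv ℝ (fun y => S.M4Inv y α β) (cz q) (cz W)) *ᵥ cZ Y))
      q W :=
    HasDirDeriv.sum fun α _ => (hM.apply α).const_mul (cZ X α)
  have hg := ((((HasDirDeriv.const (cU X * cU Y)).add
    ((HasDirDeriv.comp_cz hh).re.const_mul 4)).add
    ((hasDirDeriv_exp (-2)).mul ((hPhi X).mul (hPhi Y)))).sub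
    (((hasDirDeriv_exp (-1)).mul hdot).const_mul 2)).const_mul (1 / 4)
  refine (hg.congr_deriv ?_).congr_of_eventuallyEq
    (Filter.eventually_of_mem (QM_mem_nhds hq) fun p hp => metric_eq hp X Y)
  ring

theorem isKilling_of {k : Coord n → Coord n} {dk : Coord n → Coord n → Coord n}
    {dg : Coord n → Coord n → Coord n → ℝ}
    (hk : ∀ q ∈ S.QM, ∀ X, HasDirDeriv k (dk q X) q X)
    (hg : ∀ q ∈ S.QM, ∀ X Y, HasDirDeriv (fun p => S.metric p X Y) (dg q X Y) q (k q))
    (h : ∀ q ∈ S.QM, ∀ X Y, dg q X Y + S.metric q (dk q X) Y + S.metric q X (dk q Y) = 0) :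
    S.IsKilling k := fun q hq =>
  ⟨(hk q hq 0).1, fun X Y => ⟨(hg q hq X Y).1, by
    rw [(hg q hq X Y).2, (hk q hq X).2, (hk q hq Y).2, h q hq X Y]⟩⟩

/-- Vector fields tangent to the fibres do not differentiate the special Kähler data. -/
theorem hasDirDeriv_herm_zero (hz : z ∈ S.dom) (v w : Fin n → ℂ) :
    HasDirDeriv (fun y => S.herm y v w) 0 z 0 :=
  ⟨(((hasDirDeriv_covD hz 0 v).pair (hasDirDeriv_covD hz 0 w).star).const_mul I).1, by simp⟩

/-- Z enters the coefficients of the metric only through Φ, and the a-component ⟨Λ, Z⟩ of the field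
compensates the shift of Z there. -/
theorem isKilling_heis (Λ : SpIdx n → ℝ) : S.IsKilling (killHeis Λ) := by
  refine isKilling_of (dk := fun q X => (0, pair Λ (cZ X), 0, 0)) (fun q hq X => ?_)
    (fun q hq X Y => hasDirDeriv_metric hq X Y (h := 0) ?_) (fun q hq X Y => ?_)
  · rw [show killHeis Λ = fun q => (0, pair Λ (cZ q), 0, Λ) from funext (killHeis_eq Λ)]
    refine (HasDirDeriv.const (0 : ℝ)).prodMk (HasDirDeriv.prodMk ?_
      ((HasDirDeriv.const (0 : Fin n → ℂ)).prodMk (HasDirDeriv.const Λ)))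
    refine ((HasDirDeriv.const Λ).pair hasDirDeriv_cZ).congr_deriv ?_
    rw [pair_zero_left, zero_add]
  · rw [killHeis_eq, cz_mk]
    exact hasDirDeriv_herm_zero hq _ _
  · rw [killHeis_eq, metric_eq hq, metric_eq hq]
    have h0 : (Matrix.of fun _ _ => (0 : ℝ) : Matrix (SpIdx n) (SpIdx n) ℝ) = 0 := rfl
    simp only [cU_mk, ca_mk, cz_mk, cZ_mk, herm_zero_left, herm_zero_right, pair_zero_right,
      map_zero, h0, zero_mulVec, dotProduct_zero, zero_dotProduct, mulVec_zero, Complex.zero_re]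
    ring

theorem isKilling_central : S.IsKilling killCentral := by
  refine isKilling_of (dk := fun q X => 0) (fun q hq X => HasDirDeriv.const _)
    (fun q hq X Y => hasDirDeriv_metric hq X Y (h := 0) ?_) (fun q hq X Y => ?_)
  · exact hasDirDeriv_herm_zero hq _ _
  · rw [killCentral, metric_eq hq, metric_eq hq]
    have h0 : (Matrix.of fun _ _ => (0 : ℝ) : Matrix (SpIdx n) (SpIdx n) ℝ) = 0 := rfl
    have e : (0 : Coord n) = (0, 0, 0, 0) := rfl
    simp only [e, cU_mk, ca_mk, cz_mk, cZ_mk, herm_zero_left, herm_zero_right, pair_zero_right,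
      pair_zero_left, map_zero, h0, zero_mulVec, dotProduct_zero, zero_dotProduct, mulVec_zero,
      Complex.zero_re]
    ring

/-- The pieces are invariant separately: g by `herm_k_invariant`, Φ because T is symplectic, and
dZᵀℳ₄⁻¹dZ by `M4Inv_invariant`. -/
theorem isKilling_SK (ξ : SKIsometry S) : S.IsKilling (killSK ξ) := by
  refine isKilling_of (dk := fun q X => (0, 0, ξ.dk (cz q) (cz X), ξ.T *ᵥ cZ X))
    (fun q hq X => ?_) (fun q hq X Y => hasDirDeriv_metric hq X Y
      (ξ.herm_k_invariant hq (cz X) (cz Y))) (fun q hq X Y => ?_)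
  · refine (HasDirDeriv.const (0 : ℝ)).prodMk ((HasDirDeriv.const (0 : ℝ)).prodMk
      ((HasDirDeriv.comp_cz (ξ.hasDirDeriv_k hq (cz X))).prodMk ?_))
    refine (HasDirDeriv.mulVec (A' := 0) (fun _ _ => HasDirDeriv.const _)
      hasDirDeriv_cZ).congr_deriv ?_
    rw [zero_mulVec, zero_add]
  · have hM := congrArg (fun B => cZ X ⬝ᵥ (B *ᵥ cZ Y)) (ξ.M4Inv_invariant (z := cz q) hq)
    simp only [add_mulVec, dotProduct_add, ← mulVec_mulVec, zero_mulVec, dotProduct_zero] at hM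
    rw [dotProduct_mulVec _ ξ.Tᵀ, vecMul_transpose] at hM
    rw [killSK, metric_eq hq, metric_eq hq]
    simp only [cU_mk, ca_mk, cz_mk, cZ_mk, pair_mulVec_left ξ.T ξ.symplectic, Complex.sub_re,
      Complex.neg_re]
    linear_combination (-(1 / 2) * Real.exp (-1 * cU q)) * hM

end SpecialKahler

end CMap

end

theorem mainTheorem1 (n : ℕ) (S : CMap.SpecialKahler n) :
    (∀ q ∈ S.QM, ∀ X Y, S.curvK q X Y =
      !![S.formu q X Y, S.formv q X Y;
         -(starRingEnd ℂ) (S.formv q X Y), -S.formu q X Y]) ∧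
    (∀ Λ : CMap.SpIdx n → ℝ,
      S.IsKilling (CMap.killHeis Λ) ∧ S.IsMomentMap (CMap.killHeis Λ) (S.momentHeis Λ)) ∧
    (S.IsKilling CMap.killCentral ∧ S.IsMomentMap CMap.killCentral CMap.momentCentral) ∧
    (∀ ξ : CMap.SKIsometry S,
      S.IsKilling (CMap.killSK ξ) ∧ S.IsMomentMap (CMap.killSK ξ) (CMap.momentSK ξ)) ∧
    (∀ (k : CMap.Coord n → CMap.Coord n)
      (P P' : CMap.Coord n → Matrix (Fin 2) (Fin 2) ℂ),
      S.IsMomentMap k P → S.IsMomentMap k P' → ∀ q ∈ S.QM, P q = P' q) :=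
  ⟨fun _ hq => CMap.SpecialKahler.curvK_eq hq,
    fun Λ => ⟨CMap.SpecialKahler.isKilling_heis Λ, CMap.SpecialKahler.isMomentMap_heis Λ⟩,
    ⟨CMap.SpecialKahler.isKilling_central, CMap.SpecialKahler.isMomentMap_central⟩,
    fun ξ => ⟨CMap.SpecialKahler.isKilling_SK ξ, CMap.SpecialKahler.isMomentMap_SK ξ⟩,
    fun _ _ _ h h' _ hq => CMap.SpecialKahler.isMomentMap_unique h h' hq⟩
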